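/- **Theorem (Liveness).** Let $N,k,e,f$ be integers with $e,f\ge 0$ and $1\le k\le N-2(f+e)$ (so $1\le k\le N-2f$ when $e=0$). There are $N$ nodes $p_0,\dots,p_{N-1}$; each hosts a server and may host a client. Let $\Phi:A^k\to A^N$ be an $(N,k)$ MDS code (any $k$ coordinates of $\Phi(v)$ determine $v$), let $v_0\in A^k$ be the default value, let a quorum be a set of at least $\lceil (N+k+2e)/2\rceil$ servers, and let at most $e$ servers be malicious. Tags are pairs $(z,i)$, $z\in\mathbb Z^+$, $0\le i<N$, ordered lexicographically, and $t_0$ is an extra tag below all of them (with $z=0$). Consider the following algorithm (the unbounded self-stabilizing coded atomic storage algorithm). *Client at $p_i$* (runs at most one procedure at a time). The call $\mathrm{qrmAccess}(m)$ sends $m$ to all servers and returns the acknowledgments of this very call once a quorum has acknowledged. `writer(v)`: query the servers and let $(z,j)$ be the largest tag in the replies; with $t=(z+1,i)$ then call $\mathrm{qrmAccess}$ with $(t,\Phi_j(v),\mathrm{pre})$ for server $j$, next with $(t,\bot,\mathrm{fin})$, and next with $(t,\bot,\mathrm{FIN})$, and return. `reader()`: query the servers and let $t$ be the largest tag in the replies;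 call $\mathrm{qrmAccess}((t,\bot,\mathrm{fin}))$; if fewer than $k+2e$ of the returned replies carry a coded element for $t$, return $\bot$; otherwise decode these coded elements, correcting at most $e$ of them, and return the result. *Server at $p_i$.* It stores a finite set $S$ of records (tag, coded element or $\bot$, phase), phases being pre, fin, FIN. The coded element for $t_0$ is $\Phi_i(v_0)$; records for $t_0$ are not stored. $\mathrm{updatePhase}(t,w,u)$ adds $(t,w,u)$ if $S$ has no record with tag $t$; otherwise it upgrades the phase of that record (pre to fin if $u=\mathrm{fin}$, fin to FIN if $u=\mathrm{FIN}$, unchanged otherwise) and replaces its coded element by $w$ if $w\ne\bot$. A query of a reader is answered with the largest tag of a record in phase fin or FIN, a query of a writer with the largest tag of any record ($t_0$ if there is none). A request $(t,w,u)$ with $u\in\{\mathrm{pre},\mathrm{fin},\mathrm{FIN}\}$ causes $\mathrm{updatePhase}(t,w,u)$ and is acknowledged with $t$, and, if it comes from a reader, with the coded element that $S$ holds for $t$ (if any). A malicious server may put an arbitrary coded element into the data field of a reply; it does not withhold a coded element and deviates in no other way. Servers keep gossiping their largest tag over all phases, over $\{\mathrm{fin},\mathrm{FIN}\}$, and over $\{\mathrm{FIN}\}$.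 On arrival of gossip a server stores it as the sender's entry, then sets $\mathrm{pre}$, $\mathrm{fin}$, $\mathrm{FIN}$ of its own entry, in this order, to the largest of: all pre, fin and FIN entries and its largest tag in $S$; all fin and FIN entries and its largest tag in phase fin or FIN; all FIN entries, its largest tag in phase FIN, and any tag that is the fin entry of a quorum; after computing each it performs $\mathrm{updatePhase}$ with that tag, $\bot$ and that phase. *Communication* between a client and a server uses one token that is reliably passed back and forth; the client loads its current request (or nothing) onto it, the server the reply to the last request it received, and requests and replies are labelled with the call of $\mathrm{qrmAccess}$ that they belong to. Between two servers one gossip message at a time is in transit. Clients and servers may fail by stopping at any time. An infinite execution $R$ is *fair* if every step of the algorithm that is applicable infinitely often is taken infinitely often. The suffix $R'$ of $R$ that starts in its $n_0$-th state is *legal* if either (i) $n_0=0$ and in the first state no procedure runs, no requests or replies are in transit, all storages are empty and all gossip messages and buffers contain only $t_0$; or (ii) $R$ starts in an arbitrary state without requests or replies in transit, and a write operation $\pi$ that is completely contained in $R$ ends in the $n_0$-th state of $R$ and is valid: there is a state $c$ of $R$, not later than the start of $\pi$, such that the tag of $\pi$ is larger than all tags that occur both in $c$ and in the first state of $R$.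 Let $R$ be fair, let $R'$ be legal, and let at most $f$ servers fail. Then: 1. every operation that is ongoing in some state of $R'$ and whose client never fails terminates; 2. for every read operation that starts in $R'$ and ends, let $t$ be the tag that it uses in its finalize phase. There is $v\in A^k$ such that $v=v_0$ if $t=t_0$, and otherwise some writer has pre-written the coded elements $\Phi_j(v)$ with the tag $t$; the replies that the reader has received in its finalize phase include coded elements from at least $k+2e$ different servers $j$, of which all but at most $e$ equal $\Phi_j(v)$ (in particular they include at least $k$ distinct correct coded elements of $v$); and the reader decodes them successfully and returns $v$. -/

import Mathlib

/-!
# Coded atomic storage with self-stabilizing servers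

`N` nodes `p_0, …, p_{N-1}`; every node hosts a server and may host a client.  The file contains the
coded atomic storage algorithm (client, server and gossip code), running over a service that
circulates one token between every client and every server and one gossip token between every two
servers, the resulting transition system, and the notions of fair and of legal execution.
-/

namespace CAS

/-! ### Tags, phases, codes, quorums -/

/-- Tags `(z, i)` of write operations, ordered lexicographically. -/
abbrev Tag (N : ℕ) : Type := ℕ+ ×ₗ Fin N

/-- Tags together with the default tag `t₀ = ⊥`, which lies below all the others. -/
abbrev Tag₀ (N : ℕ) : Type := WithBot (Tag N)

/-- The tag `(z + 1, i)`, where `z` is the number in the given tag (`0` for `t₀`). -/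
def nextTag {N : ℕ} : Tag₀ N → Fin N → Tag N
  | none, i => toLex (1, i)
  | some t, i => toLex ((ofLex t).1 + 1, i)

/-- The phases of a record: `pre`, `fin` and the one written in capital letters, `FIN`. -/
inductive Phase : Type
  | pre | fin | FIN
  deriving DecidableEq

/-- The function `upgradePhase(old, new)`. -/
def upgradePhase : Phase → Phase → Phase
  | .pre, .fin => .fin
  | .fin, .FIN => .FIN
  | old, _ => old

/-- An `(N, k)` code `Φ` is maximum distance separable: any `k` coordinates determine the input. -/
def IsMDS {N k : ℕ} {A : Type*} (Φ : (Fin k → A) → Fin N → A) : Prop :=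
  ∀ S : Finset (Fin N), S.card = k →
    ∃ inv : (S → A) → (Fin k → A), ∀ x : Fin k → A, inv (fun s => Φ x s) = x

/-- Quorums: the sets of at least `⌈(N + k + 2e) / 2⌉` servers. -/
def IsQuorum {N : ℕ} (k e : ℕ) (Q : Finset (Fin N)) : Prop :=
  N + k + 2 * e ≤ 2 * Q.card

/-- What an instance of the algorithm is given: the code, the default value `v₀` of the object, and
the set of malicious servers. -/
structure Params (N k e : ℕ) (A : Type) where
  code : (Fin k → A) → Fin N → A
  v₀ : Fin k → A
  malicious : Finset (Fin N)

/-! ### Messages -/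

inductive Role : Type
  | reader | writer

/-- The requests of a client; `(⊥, ⊥, qry)`, `(t, w, pre)` and `(t, ⊥, d)` with `d` in
`{fin, FIN}`. -/
inductive Request (N : ℕ) (A : Type) : Type
  | query (r : Role)
  | prewrite (t : Tag N) (w : Option A)
  | finalize (r : Role) (t : Tag₀ N)
  | finalizeAgain (t : Tag N)

/-- The tag and the data field of a server's reply (its phase is that of the request). -/
structure Reply (N : ℕ) (A : Type) where
  tag : Tag₀ N
  word : Option A

/-- A gossip message: the maximal tags for the three kinds of phases. -/
structure Gossip (N : ℕ) where
  pre : Tag₀ N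
  fin : Tag₀ N
  FIN : Tag₀ N

/-- The gossip message `(t₀, t₀, t₀)`. -/
def Gossip.default {N : ℕ} : Gossip N := ⟨⊥, ⊥, ⊥⟩

/-- Position of the token that circulates between a client and a server.  A request, and the reply
to it, carries the number of the client's call of `qrmAccess` to which it belongs; `none` is the
empty message. -/
inductive Wire (N : ℕ) (A : Type) : Type
  | atClient
  | toServer (m : Option (ℕ × Request N A))
  | atServer
  | toClient (m : Option (ℕ × Reply N A))

/-! ### The server -/

/-- A record `(t, w, d)` of a server's storage. -/
structure Record (N : ℕ) (A : Type) where
  tag : Tag N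
  word : Option A
  phase : Phase

/-- The largest tag of a stored record with phase in `D`; `t₀` if there is none. -/
noncomputable def maxPhase {N : ℕ} {A : Type} (S : Finset (Record N A)) (D : Finset Phase) :
    Tag₀ N :=
  (S.filter fun r => r.phase ∈ D).sup fun r => (r.tag : Tag₀ N)

def allPhases : Finset Phase := {.pre, .fin, .FIN}

def finPhases : Finset Phase := {.fin, .FIN}

def lastPhase : Finset Phase := {.FIN}

open Classical in
/-- The function `updatePhase(t, w, u)`.  A record with tag `t` has its phase upgraded, and its coded
element is replaced only if `w ≠ ⊥`; if there is no such record, then `(t, w, u)` is added.  There are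
no stored records for `t₀`. -/
noncomputable def updatePhase {N : ℕ} {A : Type} (S : Finset (Record N A)) (t : Tag₀ N)
    (w : Option A) (u : Phase) : Finset (Record N A) :=
  match t with
  | none => S
  | some t =>
    if ∃ r ∈ S, r.tag = t then
      S.image fun r =>
        if r.tag = t then ⟨t, w.orElse fun _ => r.word, upgradePhase r.phase u⟩ else r
    else insert ⟨t, w, u⟩ S

open Classical in
/-- The coded element that the server with the storage `S` has for the tag `t`, if any; `w₀` is the
server's coded element of the default value `v₀`, which belongs to the tag `t₀`. -/
noncomputable def storedWord {N : ℕ} {A : Type} (S : Finset (Record N A)) (w₀ : A) :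
    Tag₀ N → Option A
  | none => some w₀
  | some t =>
    if h : ∃ w : A, ∃ r ∈ S, r.tag = t ∧ r.word = some w then some h.choose else none

/-- The state of a server: storage, outgoing gossip, most recently received gossip of every server
(with the server's own entry used for aggregation), and, for each client, the buffer with the reply
to the most recently received request. -/
structure Server (N : ℕ) (A : Type) where
  store : Finset (Record N A)
  gossipTx : Gossip N
  gossipRx : Fin N → Gossip N
  pongTx : Fin N → Option (ℕ × Reply N A)

/-- New storage and reply when a request arrives at a server. -/
noncomputable def handle {N : ℕ} {A : Type} (S : Finset (Record N A)) (w₀ : A) :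
    Request N A → Finset (Record N A) × Reply N A
  | .query .reader => (S, ⟨maxPhase S finPhases, none⟩)
  | .query .writer => (S, ⟨maxPhase S allPhases, none⟩)
  | .prewrite t w => (updatePhase S t w .pre, ⟨t, none⟩)
  | .finalize .reader t =>
      let S' := updatePhase S t none .fin
      (S', ⟨t, storedWord S' w₀ t⟩)
  | .finalize .writer t => (updatePhase S t none .fin, ⟨t, none⟩)
  | .finalizeAgain t => (updatePhase S t none .FIN, ⟨t, none⟩)

/-- The reply `r'` that server `j` gives where the algorithm asks for `r`: a malicious server may put
an arbitrary coded element into the data field, and deviates in no other way. -/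
def MayReply {N k e : ℕ} {A : Type} (P : Params N k e A) (j : Fin N) (r r' : Reply N A) : Prop :=
  r'.tag = r.tag ∧ (j ∉ P.malicious → r'.word = r.word) ∧ (r.word ≠ none → r'.word ≠ none)

open Classical in
/-- The largest tag `t` that is the `fin` entry of a quorum of the received gossip messages; `t₀` if
there is none. -/
noncomputable def quorumFin {N : ℕ} (k e : ℕ) (g : Fin N → Gossip N) : Tag₀ N :=
  (Finset.univ.filter fun l => IsQuorum k e (Finset.univ.filter fun m => (g m).fin = (g l).fin)).sup
    fun l => (g l).fin

/-- The gossip arrival event at server `i`, with the message `m` from server `j`. -/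
noncomputable def onGossip {N : ℕ} {A : Type} (k e : ℕ) (i j : Fin N) (m : Gossip N)
    (s : Server N A) : Server N A :=
  let g := Function.update s.gossipRx j m
  let pre' := (Finset.univ.sup fun l => (g l).pre ⊔ (g l).fin ⊔ (g l).FIN) ⊔ maxPhase s.store allPhases
  let g₁ := Function.update g i { g i with pre := pre' }
  let S₁ := updatePhase s.store pre' none .pre
  let fin' := (Finset.univ.sup fun l => (g₁ l).fin ⊔ (g₁ l).FIN) ⊔ maxPhase S₁ finPhases
  let g₂ := Function.update g₁ i { g₁ i with fin := fin' }
  let S₂ := updatePhase S₁ fin' none .fin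
  let FIN' := (Finset.univ.sup fun l => (g₂ l).FIN) ⊔ maxPhase S₂ lastPhase ⊔ quorumFin k e g₂
  let g₃ := Function.update g₂ i { g₂ i with FIN := FIN' }
  let S₃ := updatePhase S₂ FIN' none .FIN
  { s with
    store := S₃
    gossipRx := g₃
    gossipTx := ⟨maxPhase S₃ allPhases, maxPhase S₃ finPhases, maxPhase S₃ lastPhase⟩ }

/-! ### The client -/

/-- The calls of a client: `reader()` and `writer(v)`. -/
inductive Op (k : ℕ) (A : Type) : Type
  | read
  | write (v : Fin k → A)

def Op.role {k : ℕ} {A : Type} : Op k A → Role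
  | .read => .reader
  | .write _ => .writer

/-- Acknowledgments that a client has collected during its current call of `qrmAccess`. -/
abbrev Acks (N : ℕ) (A : Type) : Type := Fin N → Option (Reply N A)

/-- The state of a client: either no procedure is running (`idle out`, where `out` is the result of
the last call if that was a `reader()`, and `none` stands for `⊥`), or the client waits in one of the
calls of `qrmAccess`: in the query, pre-write, finalize and last phase of a writer, or in the query
and finalize phase of a reader. -/
inductive Client (N k : ℕ) (A : Type) : Type
  | idle (out : Option (Fin k → A))
  | query (op : Op k A) (acks : Acks N A)
  | prewrite (t : Tag N) (words : Fin N → Option A) (acks : Acks N A)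
  | finalizeW (t : Tag N) (acks : Acks N A)
  | finalizeAgainW (t : Tag N) (acks : Acks N A)
  | finalizeR (t : Tag₀ N) (acks : Acks N A)

namespace Client

variable {N k : ℕ} {A : Type}

def Idle : Client N k A → Prop
  | .idle _ => True
  | _ => False

/-- The request to server `j`, if the client is waiting for acknowledgments. -/
def request : Client N k A → Fin N → Option (Request N A)
  | .idle _, _ => none
  | .query op _, _ => some (.query op.role)
  | .prewrite t words _, j => some (.prewrite t (words j))
  | .finalizeW t _, _ => some (.finalize .writer t)
  | .finalizeAgainW t _, _ => some (.finalizeAgain t)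
  | .finalizeR t _, _ => some (.finalize .reader t)

def acks : Client N k A → Acks N A
  | .idle _ => fun _ => none
  | .query _ a | .prewrite _ _ a | .finalizeW _ a | .finalizeAgainW _ a | .finalizeR _ a => a

/-- Store the acknowledgment `r` from server `j`. -/
def addAck : Client N k A → Fin N → Reply N A → Client N k A
  | .idle out, _, _ => .idle out
  | .query op a, j, r => .query op (Function.update a j (some r))
  | .prewrite t ws a, j, r => .prewrite t ws (Function.update a j (some r))
  | .finalizeW t a, j, r => .finalizeW t (Function.update a j (some r))
  | .finalizeAgainW t a, j, r => .finalizeAgainW t (Function.update a j (some r))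
  | .finalizeR t a, j, r => .finalizeR t (Function.update a j (some r))

end Client

/-- The set of servers that have acknowledged. -/
def ackSet {N : ℕ} {A : Type} (a : Acks N A) : Finset (Fin N) :=
  Finset.univ.filter fun j => (a j).isSome

/-- The maximal tag in the replies to a query. -/
def maxTag {N : ℕ} {A : Type} (a : Acks N A) : Tag₀ N :=
  Finset.univ.sup fun j => ((a j).map Reply.tag).getD ⊥

open Classical in
/-- The coded element for the tag `t` in the acknowledgment of server `j`, if it has one. -/
noncomputable def ackWord {N : ℕ} {A : Type} (t : Tag₀ N) (a : Acks N A) (j : Fin N) : Option A :=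
  (a j).bind fun r => if r.tag = t then r.word else none

/-- The servers from which a coded element has been received. -/
def received {N : ℕ} {A : Type} (ws : Fin N → Option A) : Finset (Fin N) :=
  Finset.univ.filter fun j => (ws j).isSome

open Classical in
/-- The servers from which the coded element of `v` has been received. -/
noncomputable def matching {N k : ℕ} {A : Type} (Φ : (Fin k → A) → Fin N → A)
    (ws : Fin N → Option A) (v : Fin k → A) : Finset (Fin N) :=
  Finset.univ.filter fun j => ws j = some (Φ v j)

open Classical in
/-- The value that a reader returns: `⊥` if there are fewer than `k + 2e` coded elements, and otherwise
the result of decoding while correcting at most `e` of them. -/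
noncomputable def decode {N k : ℕ} {A : Type} (e : ℕ) (Φ : (Fin k → A) → Fin N → A)
    (ws : Fin N → Option A) : Option (Fin k → A) :=
  if h : k + 2 * e ≤ (received ws).card ∧
      ∃ v : Fin k → A, (received ws).card ≤ (matching Φ ws v).card + e then
    some h.2.choose
  else none

/-- What the client at node `i` does when its current call of `qrmAccess` returns. -/
noncomputable def Client.advance {N k e : ℕ} {A : Type} (P : Params N k e A) (i : Fin N) :
    Client N k A → Client N k A
  | .idle out => .idle out
  | .query .read a => .finalizeR (maxTag a) fun _ => none
  | .query (.write v) a =>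
      .prewrite (nextTag (maxTag a) i) (fun j => some (P.code v j)) fun _ => none
  | .prewrite t _ _ => .finalizeW t fun _ => none
  | .finalizeW t _ => .finalizeAgainW t fun _ => none
  | .finalizeAgainW _ _ => .idle none
  | .finalizeR t a => .idle (decode e P.code (ackWord t a))

/-! ### System states and steps -/

/-- A system state: clients, the number of the current call of `qrmAccess` of each client, servers, the
token between each client and each server, the gossip message in transit from one server to another
(if any), and the sets of clients and of servers that have failed. -/
structure State (N k : ℕ) (A : Type) where
  client : Fin N → Client N k A
  calls : Fin N → ℕ
  server : Fin N → Server N A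
  wire : Fin N → Fin N → Wire N A
  gossipWire : Fin N → Fin N → Option (Gossip N)
  deadClients : Finset (Fin N)
  deadServers : Finset (Fin N)

/-- Names of steps.  In the ping and pong steps the first index is the client and the second the
server; in the gossip steps the first is the sender and the second the receiver. -/
inductive Label (N k : ℕ) (A : Type) : Type
  | pingDepart (i j : Fin N)
  | pingArrive (i j : Fin N)
  | pongDepart (i j : Fin N)
  | pongArrive (i j : Fin N)
  | advance (i : Fin N)
  | gossipDepart (i j : Fin N)
  | gossipArrive (i j : Fin N)
  | invoke (i : Fin N) (op : Op k A)
  | crashClient (i : Fin N)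
  | crashServer (j : Fin N)
  | skip

/-- The steps of the algorithm, as opposed to those of the environment. -/
def Label.IsAlgorithmStep {N k : ℕ} {A : Type} : Label N k A → Prop
  | .invoke _ _ | .crashClient _ | .crashServer _ | .skip => False
  | _ => True

namespace State

variable {N k : ℕ} {A : Type}

def setClient (s : State N k A) (i : Fin N) (c : Client N k A) : State N k A :=
  { s with client := Function.update s.client i c }

def setServer (s : State N k A) (j : Fin N) (x : Server N A) : State N k A :=
  { s with server := Function.update s.server j x }

def setWire (s : State N k A) (i j : Fin N) (w : Wire N A) : State N k A :=
  { s with wire := Function.update s.wire i (Function.update (s.wire i) j w) }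

def setGossipWire (s : State N k A) (i j : Fin N) (m : Option (Gossip N)) : State N k A :=
  { s with gossipWire := Function.update s.gossipWire i (Function.update (s.gossipWire i) j m) }

def setPong (s : State N k A) (j i : Fin N) (m : Option (ℕ × Reply N A)) : State N k A :=
  s.setServer j { s.server j with pongTx := Function.update (s.server j).pongTx i m }

def setStore (s : State N k A) (j : Fin N) (S : Finset (Record N A)) : State N k A :=
  s.setServer j { s.server j with store := S }

def newCall (s : State N k A) (i : Fin N) : State N k A :=
  { s with calls := Function.update s.calls i (s.calls i + 1) }

end State

/-- The steps of the system. -/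
inductive Step {N k e : ℕ} {A : Type} (P : Params N k e A) :
    State N k A → Label N k A → State N k A → Prop
  /-- The client at `i`, which runs no procedure, is called and starts its query. -/
  | invoke (s : State N k A) (i : Fin N) (op : Op k A)
      (alive : i ∉ s.deadClients) (h : (s.client i).Idle) :
      Step P s (.invoke i op) ((s.setClient i (.query op fun _ => none)).newCall i)
  /-- The token leaves the client with its current request (or empty). -/
  | pingDepart (s : State N k A) (i j : Fin N)
      (alive : i ∉ s.deadClients) (h : s.wire i j = .atClient) :
      Step P s (.pingDepart i j)
        (s.setWire i j (.toServer (((s.client i).request j).map fun q => (s.calls i, q))))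
  /-- The token reaches the server without a request. -/
  | pingArriveEmpty (s : State N k A) (i j : Fin N)
      (alive : j ∉ s.deadServers) (h : s.wire i j = .toServer none) :
      Step P s (.pingArrive i j) ((s.setPong j i none).setWire i j .atServer)
  /-- The token reaches the server with a request, which the server handles. -/
  | pingArrive (s : State N k A) (i j : Fin N) (n : ℕ) (q : Request N A) (r : Reply N A)
      (alive : j ∉ s.deadServers) (h : s.wire i j = .toServer (some (n, q)))
      (hr : MayReply P j (handle (s.server j).store (P.code P.v₀ j) q).2 r) :
      Step P s (.pingArrive i j)
        (((s.setStore j (handle (s.server j).store (P.code P.v₀ j) q).1).setPong j i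
          (some (n, r))).setWire i j .atServer)
  /-- The token leaves the server with the content of the reply buffer. -/
  | pongDepart (s : State N k A) (i j : Fin N)
      (alive : j ∉ s.deadServers) (h : s.wire i j = .atServer) :
      Step P s (.pongDepart i j) (s.setWire i j (.toClient ((s.server j).pongTx i)))
  /-- The token reaches the client with an acknowledgment of the current request. -/
  | pongArrive (s : State N k A) (i j : Fin N) (r : Reply N A)
      (alive : i ∉ s.deadClients) (h : s.wire i j = .toClient (some (s.calls i, r))) :
      Step P s (.pongArrive i j)
        ((s.setClient i ((s.client i).addAck j r)).setWire i j .atClient)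
  /-- The token reaches the client with anything else, which is ignored. -/
  | pongArriveOther (s : State N k A) (i j : Fin N) (m : Option (ℕ × Reply N A))
      (alive : i ∉ s.deadClients) (h : s.wire i j = .toClient m)
      (hm : ∀ r : Reply N A, m ≠ some (s.calls i, r)) :
      Step P s (.pongArrive i j) (s.setWire i j .atClient)
  /-- A quorum has acknowledged the request of the client at `i`: the call of `qrmAccess` returns, and
  the client starts its next phase or returns from its procedure. -/
  | advance (s : State N k A) (i : Fin N)
      (alive : i ∉ s.deadClients) (busy : ¬ (s.client i).Idle)
      (h : IsQuorum k e (ackSet (s.client i).acks)) :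
      Step P s (.advance i) ((s.setClient i ((s.client i).advance P i)).newCall i)
  /-- Server `i` sends its current gossip message to server `j`. -/
  | gossipDepart (s : State N k A) (i j : Fin N) (ne : i ≠ j)
      (alive : i ∉ s.deadServers) (h : s.gossipWire i j = none) :
      Step P s (.gossipDepart i j) (s.setGossipWire i j (some (s.server i).gossipTx))
  /-- A gossip message from server `i` reaches server `j`. -/
  | gossipArrive (s : State N k A) (i j : Fin N) (m : Gossip N) (ne : i ≠ j)
      (alive : j ∉ s.deadServers) (h : s.gossipWire i j = some m) :
      Step P s (.gossipArrive i j)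
        ((s.setServer j (onGossip k e j i m (s.server j))).setGossipWire i j none)
  | crashClient (s : State N k A) (i : Fin N) :
      Step P s (.crashClient i) { s with deadClients := insert i s.deadClients }
  | crashServer (s : State N k A) (j : Fin N) :
      Step P s (.crashServer j) { s with deadServers := insert j s.deadServers }
  | skip (s : State N k A) : Step P s .skip s

/-! ### Executions -/

/-- An (unbounded) execution, from an arbitrary system state. -/
structure Execution {N k e : ℕ} {A : Type} (P : Params N k e A) where
  state : ℕ → State N k A
  label : ℕ → Label N k A
  step : ∀ n, Step P (state n) (label n) (state (n + 1))

/-- Fairness: every step of the algorithm that is applicable infinitely often is taken infinitely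
often. -/
def Execution.Fair {N k e : ℕ} {A : Type} {P : Params N k e A} (R : Execution P) : Prop :=
  ∀ l : Label N k A, l.IsAlgorithmStep →
    (∃ᶠ n in Filter.atTop, ∃ s' : State N k A, Step P (R.state n) l s') →
      ∃ᶠ n in Filter.atTop, R.label n = l

namespace State

variable {N k : ℕ} {A : Type}

/-- No request and no reply is in transit or waits in a server's reply buffer, so that all those
delivered later on have been sent later on. -/
def NoStaleMessages (s : State N k A) : Prop :=
  (∀ i j, s.wire i j = .atClient ∨ s.wire i j = .toServer none ∨ s.wire i j = .atServer ∨
    s.wire i j = .toClient none) ∧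
  ∀ i j, (s.server j).pongTx i = none

/-- The well-initialized states: no procedure is running, no requests and replies are in transit, all
gossip messages are `(t₀, t₀, t₀)`, and all storages are empty. -/
def Safe (s : State N k A) : Prop :=
  s.NoStaleMessages ∧
  (∀ i, (s.client i).Idle) ∧
  (∀ i j, s.gossipWire i j = none ∨ s.gossipWire i j = some .default) ∧
  ∀ j, (s.server j).store = ∅ ∧ (s.server j).gossipTx = .default ∧
    ∀ l, (s.server j).gossipRx l = .default

end State

/-! ### The tags in a system state -/

section Tags

variable {N k : ℕ} {A : Type}

def Gossip.HasTag (g : Gossip N) (t : Tag N) : Prop :=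
  g.pre = t ∨ g.fin = t ∨ g.FIN = t

def Request.HasTag : Request N A → Tag N → Prop
  | .query _, _ => False
  | .prewrite t' _, t => t' = t
  | .finalize _ t', t => t' = t
  | .finalizeAgain t', t => t' = t

def Wire.HasTag : Wire N A → Tag N → Prop
  | .atClient, _ | .atServer, _ => False
  | .toServer m, t => ∃ n q, m = some (n, q) ∧ Request.HasTag q t
  | .toClient m, t => ∃ n r, m = some (n, r) ∧ r.tag = t

def Server.HasTag (s : Server N A) (t : Tag N) : Prop :=
  (∃ r ∈ s.store, r.tag = t) ∨ s.gossipTx.HasTag t ∨ (∃ l, (s.gossipRx l).HasTag t) ∨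
    ∃ i n r, s.pongTx i = some (n, r) ∧ r.tag = t

def Client.HasTag (c : Client N k A) (t : Tag N) : Prop :=
  (∃ j q, c.request j = some q ∧ q.HasTag t) ∨ ∃ j r, c.acks j = some r ∧ r.tag = t

/-- The tag `t` occurs in the state of a node or in a message in transit. -/
def State.HasTag (s : State N k A) (t : Tag N) : Prop :=
  (∃ i, (s.client i).HasTag t) ∨ (∃ j, (s.server j).HasTag t) ∨ (∃ i j, (s.wire i j).HasTag t) ∨
    ∃ i j g, s.gossipWire i j = some g ∧ g.HasTag t

end Tags

/-! ### Operations and legal executions -/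

namespace Execution

variable {N k e : ℕ} {A : Type} {P : Params N k e A}

/-- Step `a` invokes `op` at the client of node `i`, and step `b` is the one that ends this operation:
the client is busy in all states between them and is not after step `b`. -/
def CompleteOp (R : Execution P) (i : Fin N) (op : Op k A) (a b : ℕ) : Prop :=
  a < b ∧ R.label a = .invoke i op ∧ (∀ n, a < n → n ≤ b → ¬ ((R.state n).client i).Idle) ∧
    ((R.state (b + 1)).client i).Idle

/-- The complete write operation that starts at step `a` and ends at step `b` has the tag `t`, and is
valid: there is a system state, no later than the start of the operation, such that `t` is greater than
all the tags that occur both in it and in the starting state of the execution. -/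
def ValidWrite (R : Execution P) (i : Fin N) (a b : ℕ) (t : Tag N) : Prop :=
  (∃ v, R.CompleteOp i (.write v) a b) ∧
  (∃ acks, (R.state b).client i = .finalizeAgainW t acks) ∧
  ∃ m, m ≤ a ∧ ∀ t' : Tag N, (R.state 0).HasTag t' → (R.state m).HasTag t' → t' < t

/-- The suffix of the execution from its `n`-th state on is a legal execution: either the execution
starts in a well-initialized state and `n = 0`, or it starts in an arbitrary state without stale
requests and replies in transit, and a complete and valid write operation ends in its `n`-th state. -/
def LegalFrom (R : Execution P) (n : ℕ) : Prop :=
  (n = 0 ∧ (R.state 0).Safe) ∨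
  ((R.state 0).NoStaleMessages ∧ ∃ i a b t, R.ValidWrite i a b t ∧ n = b + 1)

/-- The value `v` has been written with the tag `t`, by step `b`: it is the default value and `t = t₀`,
or a writer has pre-written with the tag `t` the coded elements of `v`. -/
def IsVersion (R : Execution P) (b : ℕ) (t : Tag₀ N) (v : Fin k → A) : Prop :=
  (t = ⊥ ∧ v = P.v₀) ∨
  ∃ m, m ≤ b ∧ ∃ (i : Fin N) (τ : Tag N) (acks : Acks N A), t = τ ∧
    (R.state m).client i = .prewrite τ (fun j => some (P.code v j)) acks

end Execution

end CAS

namespace CAS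

/-! ### Tags and suprema -/

/-! Both halves rest on quorum counting: two quorums share at least k + 2e servers
(`IsQuorum.card_inter`), and since k + 2(f + e) ≤ N the servers that never fail form a quorum
(`isQuorum_correctServers`).

Termination. Fairness keeps each token between a correct client and a correct server moving
(`exists_exit`), so every correct server eventually acknowledges a pending call (`exists_ack`).
Hence each call returns (`exists_advance`), and a procedure consists of at most four calls
(`exists_idle`).

Reads. Call numbers ensure that the acknowledgments of a call begun during the execution come from
servers that handled that very request (`exists_handled`). Consider a tag τ that is absent from some
state. It comes into use only when the client whose index it carries starts to pre-write some v with
it, and it is not finalized before that pre-write phase returns (`unused_or_carries`). By then a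
quorum stores coded elements for τ. From then on no writer can create τ again: its query quorum
meets the pre-write quorum, so its new tag exceeds τ (`PreWritten.not_creates`). Thus every coded
element stored for τ is that of the single value v.

The tag of a read in a legal suffix is either t₀ or absent from some earlier state
(`LegalFrom.exists_not_hasTag`). This is clear after a well-initialized start. After a valid write
with tag t, the query quorum of the reader meets the quorum that finalized t, so the reader obtains
a tag at least t, and validity says that such a tag is missing from one of two specific states.

Finally, the quorum that answers the reader's finalize request meets the pre-write quorum in at
least k + 2e servers, all of which return some coded element; only the at most e malicious ones can
return a wrong one (`CompleteOp.read_returns`). Two candidate values, each contradicted by at most e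
of the received elements, agree in k coordinates, so by the MDS property decoding is unambiguous
(`IsMDS.eq_of_matching`). -/

theorem sup_ne_coe {N : ℕ} {ι : Type*} {s : Finset ι} {g : ι → Tag₀ N} {τ : Tag N}
    (h : ∀ i ∈ s, g i ≠ τ) : s.sup g ≠ τ := by
  refine Finset.sup_induction (p := fun x : Tag₀ N => x ≠ τ) (by simp) ?_ h
  intro x hx y hy
  rcases le_total x y with hxy | hxy
  · rwa [sup_eq_right.2 hxy]
  · rwa [sup_eq_left.2 hxy]

theorem sup_ne {N : ℕ} {x y z : Tag₀ N} (hx : x ≠ z) (hy : y ≠ z) : x ⊔ y ≠ z := by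
  rcases le_total x y with hxy | hxy
  · rwa [sup_eq_right.2 hxy]
  · rwa [sup_eq_left.2 hxy]

theorem nextTag_snd {N : ℕ} (t : Tag₀ N) (i : Fin N) : (ofLex (nextTag t i)).2 = i := by
  cases t <;> rfl

theorem lt_nextTag {N : ℕ} (t : Tag₀ N) (i : Fin N) : t < (nextTag t i : Tag₀ N) := by
  cases t using WithBot.recBotCoe with
  | bot => exact WithBot.bot_lt_coe _
  | coe t =>
    refine WithBot.coe_lt_coe.2 (Prod.Lex.lt_iff.2 (Or.inl ?_))
    exact PNat.lt_add_right _ _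

/-! ### Quorums -/

/-- Inclusion-exclusion: the two sizes add up to at least N + k + 2e, while the union has at most N
elements. -/
theorem IsQuorum.card_inter {N k e : ℕ} {Q Q' : Finset (Fin N)} (h : IsQuorum k e Q)
    (h' : IsQuorum k e Q') : k + 2 * e ≤ (Q ∩ Q').card := by
  have h₁ := Finset.card_union_add_card_inter Q Q'
  have h₂ : (Q ∪ Q').card ≤ N := by simpa using Finset.card_le_univ (Q ∪ Q')
  unfold IsQuorum at h h'
  omega

theorem IsQuorum.mono {N k e : ℕ} {Q Q' : Finset (Fin N)} (h : IsQuorum k e Q) (hQ : Q ⊆ Q') :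
    IsQuorum k e Q' := by
  have := Finset.card_le_card hQ
  unfold IsQuorum at *
  omega

theorem IsQuorum.exists_common {N k e : ℕ} (hk : 1 ≤ k) {Q Q' : Finset (Fin N)}
    (h : IsQuorum k e Q) (h' : IsQuorum k e Q') : ∃ j ∈ Q, j ∈ Q' := by
  have h₁ := h.card_inter h'
  obtain ⟨j, hj⟩ := Finset.card_pos.1 (show 0 < (Q ∩ Q').card by omega)
  exact ⟨j, Finset.mem_inter.1 hj⟩

/-! ### Decoding -/

theorem matching_subset_received {N k : ℕ} {A : Type} (Φ : (Fin k → A) → Fin N → A)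
    (ws : Fin N → Option A) (v : Fin k → A) : matching Φ ws v ⊆ received ws := by
  intro j hj
  simp only [matching, received, Finset.mem_filter, Finset.mem_univ, true_and] at hj ⊢
  simp [hj]

/-- Each value disagrees with at most e received elements, so at least (k + 2e) - 2e = k of them
agree with both, and k coordinates determine the value. -/
theorem IsMDS.eq_of_matching {N k e : ℕ} {A : Type} {Φ : (Fin k → A) → Fin N → A}
    (hΦ : IsMDS Φ) {ws : Fin N → Option A} {v v' : Fin k → A}
    (hr : k + 2 * e ≤ (received ws).card)
    (h : (received ws).card ≤ (matching Φ ws v).card + e)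
    (h' : (received ws).card ≤ (matching Φ ws v').card + e) : v = v' := by
  have h₁ := Finset.card_union_add_card_inter (matching Φ ws v) (matching Φ ws v')
  have h₂ := Finset.card_le_card
    (Finset.union_subset (matching_subset_received Φ ws v) (matching_subset_received Φ ws v'))
  obtain ⟨S, hS, hSk⟩ := Finset.exists_subset_card_eq
    (show k ≤ (matching Φ ws v ∩ matching Φ ws v').card by omega)
  obtain ⟨inv, hinv⟩ := hΦ S hSk
  rw [← hinv v, ← hinv v']
  congr 1
  funext s
  have hs := Finset.mem_inter.1 (hS s.2)
  simp only [matching, Finset.mem_filter, Finset.mem_univ, true_and] at hs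
  exact Option.some.inj (hs.1.symm.trans hs.2)

theorem decode_eq_some {N k e : ℕ} {A : Type} {Φ : (Fin k → A) → Fin N → A}
    (hΦ : IsMDS Φ) {ws : Fin N → Option A} {v : Fin k → A}
    (hr : k + 2 * e ≤ (received ws).card)
    (h : (received ws).card ≤ (matching Φ ws v).card + e) : decode e Φ ws = some v := by
  have hc : k + 2 * e ≤ (received ws).card ∧
      ∃ v : Fin k → A, (received ws).card ≤ (matching Φ ws v).card + e := ⟨hr, v, h⟩
  rw [decode, dif_pos hc]
  exact congrArg some (hΦ.eq_of_matching hr hc.2.choose_spec h)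

/-! ### Storages -/

section Store

variable {N : ℕ} {A : Type}

/-- Every record of `updatePhase` is an old one, an upgraded old one or the new one. -/
theorem mem_updatePhase {S : Finset (Record N A)} {t : Tag₀ N} {w : Option A} {u : Phase}
    {r : Record N A} (h : r ∈ updatePhase S t w u) :
    (r ∈ S) ∨
    (∃ r' ∈ S, (r'.tag : Tag₀ N) = t ∧
      r = ⟨r'.tag, w.orElse fun _ => r'.word, upgradePhase r'.phase u⟩) ∨
    ((r.tag : Tag₀ N) = t ∧ r.word = w ∧ r.phase = u) := by
  classical
  cases t using WithBot.recBotCoe with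
  | bot => exact Or.inl h
  | coe t =>
    change r ∈ (if ∃ r ∈ S, r.tag = t then _ else _) at h
    split_ifs at h with hex
    · obtain ⟨r', hr', rfl⟩ := Finset.mem_image.1 h
      split_ifs with ht
      · exact Or.inr (Or.inl ⟨r', hr', congrArg _ ht, by rw [ht]⟩)
      · exact Or.inl hr'
    · rcases Finset.mem_insert.1 h with rfl | h
      · exact Or.inr (Or.inr ⟨rfl, rfl, rfl⟩)
      · exact Or.inl h

/-- The records of `S` persist in `S'`: they keep some coded element if they have one, and they
remain finalized if they are. -/
def Persists (S S' : Finset (Record N A)) : Prop :=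
  ∀ r ∈ S, ∃ r' ∈ S', r'.tag = r.tag ∧ (r.word ≠ none → r'.word ≠ none) ∧
    (r.phase ∈ finPhases → r'.phase ∈ finPhases)

theorem Persists.refl (S : Finset (Record N A)) : Persists S S :=
  fun r hr => ⟨r, hr, rfl, id, id⟩

theorem Persists.trans {S S' S'' : Finset (Record N A)} (h : Persists S S')
    (h' : Persists S' S'') : Persists S S'' := by
  intro r hr
  obtain ⟨r', hr', h₁, h₂, h₃⟩ := h r hr
  obtain ⟨r'', hr'', h₁', h₂', h₃'⟩ := h' r' hr'
  exact ⟨r'', hr'', h₁'.trans h₁, h₂' ∘ h₂, h₃' ∘ h₃⟩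

theorem upgradePhase_mem_finPhases {p u : Phase} (h : p ∈ finPhases) :
    upgradePhase p u ∈ finPhases := by
  cases p <;> cases u <;> simp_all [finPhases, upgradePhase]

theorem upgradePhase_fin (p : Phase) : upgradePhase p .fin ∈ finPhases := by
  cases p <;> simp [finPhases, upgradePhase]

theorem upgradePhase_pre (p : Phase) : upgradePhase p .pre = p := by
  cases p <;> rfl

theorem persists_updatePhase (S : Finset (Record N A)) (t : Tag₀ N) (w : Option A) (u : Phase) :
    Persists S (updatePhase S t w u) := by
  classical
  cases t using WithBot.recBotCoe with
  | bot => exact Persists.refl S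
  | coe t =>
    intro r hr
    change ∃ r' ∈ (if ∃ r ∈ S, r.tag = t then _ else _), _
    split_ifs with hex
    · refine ⟨_, Finset.mem_image_of_mem _ hr, ?_⟩
      split_ifs with ht
      · refine ⟨ht.symm, ?_, upgradePhase_mem_finPhases⟩
        intro hw
        cases w <;> simp [hw]
      · exact ⟨rfl, id, id⟩
    · exact ⟨r, Finset.mem_insert_of_mem hr, rfl, id, id⟩

theorem exists_mem_updatePhase_fin (S : Finset (Record N A)) (t : Tag N) (w : Option A) :
    ∃ r ∈ updatePhase S t w .fin, r.tag = t ∧ r.phase ∈ finPhases := by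
  classical
  change ∃ r' ∈ (if ∃ r ∈ S, r.tag = t then _ else _), _
  split_ifs with hex
  · obtain ⟨r, hr, ht⟩ := hex
    refine ⟨_, Finset.mem_image_of_mem _ hr, ?_⟩
    rw [if_pos ht]
    exact ⟨rfl, upgradePhase_fin _⟩
  · exact ⟨_, Finset.mem_insert_self _ _, rfl, by simp [finPhases]⟩

theorem exists_mem_updatePhase_word (S : Finset (Record N A)) (t : Tag N) (w : A) (u : Phase) :
    ∃ r ∈ updatePhase S t (some w) u, r.tag = t ∧ r.word ≠ none := by
  classical
  change ∃ r' ∈ (if ∃ r ∈ S, r.tag = t then _ else _), _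
  split_ifs with hex
  · obtain ⟨r, hr, ht⟩ := hex
    refine ⟨_, Finset.mem_image_of_mem _ hr, ?_⟩
    rw [if_pos ht]
    exact ⟨rfl, by simp⟩
  · exact ⟨_, Finset.mem_insert_self _ _, rfl, by simp⟩

theorem persists_handle (S : Finset (Record N A)) (w₀ : A) (q : Request N A) :
    Persists S (handle S w₀ q).1 := by
  rcases q with (_ | _) | _ | ⟨_ | _, _⟩ | _
  all_goals first | exact Persists.refl S | exact persists_updatePhase _ _ _ _

theorem persists_onGossip (k e : ℕ) (i j : Fin N) (m : Gossip N) (s : Server N A) :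
    Persists s.store (onGossip k e i j m s).store :=
  (persists_updatePhase _ _ _ _).trans ((persists_updatePhase _ _ _ _).trans (persists_updatePhase _ _ _ _))

theorem le_maxPhase {S : Finset (Record N A)} {D : Finset Phase} {r : Record N A} (hr : r ∈ S)
    (hD : r.phase ∈ D) : (r.tag : Tag₀ N) ≤ maxPhase S D :=
  Finset.le_sup (f := fun r : Record N A => (r.tag : Tag₀ N)) (Finset.mem_filter.2 ⟨hr, hD⟩)

theorem mem_allPhases (p : Phase) : p ∈ allPhases := by
  cases p <;> simp [allPhases]

/-- The coded elements that are stored for `τ` equal `x`. -/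
def OnlyWord (τ : Tag N) (x : A) (S : Finset (Record N A)) : Prop :=
  ∀ r ∈ S, r.tag = τ → r.word = none ∨ r.word = some x

theorem OnlyWord.updatePhase {τ : Tag N} {x : A} {S : Finset (Record N A)} (h : OnlyWord τ x S)
    {t : Tag₀ N} {w : Option A} {u : Phase} (hw : t = τ → w = none ∨ w = some x) :
    OnlyWord τ x (updatePhase S t w u) := by
  intro r hr hτ
  rcases mem_updatePhase hr with hr | ⟨r', hr', rfl, rfl⟩ | ⟨rfl, rfl, -⟩
  · exact h r hr hτ
  · have h' := h r' hr' hτ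
    rcases hw (congrArg _ hτ) with rfl | rfl
    · simpa using h'
    · simp
  · exact hw (congrArg _ hτ)

theorem OnlyWord.onGossip {τ : Tag N} {x : A} {s : Server N A} (h : OnlyWord τ x s.store)
    (k e : ℕ) (i j : Fin N) (m : Gossip N) : OnlyWord τ x (onGossip k e i j m s).store :=
  ((h.updatePhase fun _ => Or.inl rfl).updatePhase fun _ => Or.inl rfl).updatePhase
    fun _ => Or.inl rfl

theorem OnlyWord.handle {τ : Tag N} {x : A} {S : Finset (Record N A)} (h : OnlyWord τ x S)
    (w₀ : A) {q : Request N A} (hq : ∀ w, q = .prewrite τ w → w = some x) :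
    OnlyWord τ x (handle S w₀ q).1 := by
  rcases q with (_ | _) | ⟨t, w⟩ | ⟨_ | _, _⟩ | _
  · exact h
  · exact h
  · refine h.updatePhase fun ht => Or.inr (hq w ?_)
    rw [WithBot.coe_inj.1 ht]
  all_goals exact h.updatePhase fun _ => Or.inl rfl

/-- `storedWord` chooses among the elements stored for `τ`; since all of them equal `x`, the choice
does not matter. -/
theorem OnlyWord.storedWord {τ : Tag N} {x : A} {S : Finset (Record N A)} (h : OnlyWord τ x S)
    (w₀ : A) : storedWord S w₀ τ = none ∨ storedWord S w₀ τ = some x := by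
  classical
  change (if h : ∃ w : A, ∃ r ∈ S, r.tag = τ ∧ r.word = some w then some h.choose else none) = none
    ∨ (if h : ∃ w : A, ∃ r ∈ S, r.tag = τ ∧ r.word = some w then some h.choose else none) = some x
  split_ifs with hex
  · obtain ⟨r, hr, ht, hw⟩ := hex.choose_spec
    rcases h r hr ht with h' | h'
    · simp [h'] at hw
    · exact Or.inr (hw.symm.trans h')
  · exact Or.inl rfl

theorem storedWord_ne_none {τ : Tag N} {S : Finset (Record N A)} {r : Record N A} (hr : r ∈ S)
    (ht : r.tag = τ) (hw : r.word ≠ none) (w₀ : A) : storedWord S w₀ τ ≠ none := by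
  obtain ⟨w, hw⟩ := Option.ne_none_iff_exists'.1 hw
  have hex : ∃ w : A, ∃ r ∈ S, r.tag = τ ∧ r.word = some w := ⟨w, r, hr, ht, hw⟩
  classical
  change (if h : ∃ w : A, ∃ r ∈ S, r.tag = τ ∧ r.word = some w then some h.choose else none) ≠ none
  simp [hex]

/-- The tag `τ` occurs in `S` only in phase `pre`. -/
def Unfinalized (τ : Tag N) (S : Finset (Record N A)) : Prop :=
  ∀ r ∈ S, r.tag = τ → r.phase = .pre

/-- Upgrading by `pre` leaves every phase unchanged, so an update of `τ` itself is harmless as long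
as it is made in phase `pre`. -/
theorem Unfinalized.updatePhase {τ : Tag N} {S : Finset (Record N A)} (h : Unfinalized τ S)
    {t : Tag₀ N} {w : Option A} {u : Phase} (hu : t = τ → u = .pre) :
    Unfinalized τ (updatePhase S t w u) := by
  intro r hr hτ
  rcases mem_updatePhase hr with hr | ⟨r', hr', rfl, rfl⟩ | ⟨rfl, -, rfl⟩
  · exact h r hr hτ
  · have h' := h r' hr' hτ
    rw [hu (congrArg _ hτ)]
    simp [upgradePhase_pre, h']
  · exact hu (congrArg _ hτ)

theorem Unfinalized.maxPhase_ne {τ : Tag N} {S : Finset (Record N A)} (h : Unfinalized τ S)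
    {D : Finset Phase} (hD : .pre ∉ D) : maxPhase S D ≠ τ := by
  refine sup_ne_coe fun r hr hτ => hD ?_
  obtain ⟨hr, hp⟩ := Finset.mem_filter.1 hr
  rwa [h r hr (WithBot.coe_inj.1 hτ)] at hp

theorem pre_notMem_finPhases : Phase.pre ∉ finPhases := by simp [finPhases]

theorem pre_notMem_lastPhase : Phase.pre ∉ lastPhase := by simp [lastPhase]

/-- The tag `τ` occurs in `g` at most as a `pre` entry. -/
def Gossip.Unfinalized (τ : Tag N) (g : Gossip N) : Prop :=
  g.fin ≠ τ ∧ g.FIN ≠ τ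

/-- No storage or gossip entry of the server contains `τ` in a phase other than `pre`. -/
def Server.Unfinalized (τ : Tag N) (s : Server N A) : Prop :=
  CAS.Unfinalized τ s.store ∧ s.gossipTx.Unfinalized τ ∧ ∀ l, (s.gossipRx l).Unfinalized τ

/-- Information flows only from higher phases to lower ones, except that a `FIN` entry may come from
a quorum of `fin` entries. Hence `τ` can become the `pre` entry, but the new `fin` and `FIN` entries
are suprema of tags different from `τ`. -/
theorem Server.Unfinalized.onGossip {τ : Tag N} {s : Server N A} (h : s.Unfinalized τ) (k e : ℕ)
    (i j : Fin N) {m : Gossip N} (hm : m.Unfinalized τ) : (onGossip k e i j m s).Unfinalized τ := by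
  obtain ⟨hS, -, hg⟩ := h
  unfold CAS.onGossip
  extract_lets g pre' c₁ g₁ S₁ fin' c₂ g₂ S₂ FIN' c₃ g₃ S₃
  have h₀ : ∀ l, (g l).Unfinalized τ := by
    intro l
    simp only [g, Function.update_apply]
    split_ifs
    · exact hm
    · exact hg l
  have h₁ : ∀ l, (g₁ l).Unfinalized τ := by
    intro l
    simp only [g₁, Function.update_apply]
    split_ifs
    · exact h₀ i
    · exact h₀ l
  have hS₁ : CAS.Unfinalized τ S₁ := hS.updatePhase fun _ => rfl
  have hfin : fin' ≠ τ := sup_ne (sup_ne_coe fun l _ => sup_ne (h₁ l).1 (h₁ l).2)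
    (hS₁.maxPhase_ne pre_notMem_finPhases)
  have h₂ : ∀ l, (g₂ l).Unfinalized τ := by
    intro l
    simp only [g₂, Function.update_apply]
    split_ifs
    · exact ⟨hfin, (h₁ i).2⟩
    · exact h₁ l
  have hS₂ : CAS.Unfinalized τ S₂ := hS₁.updatePhase fun h => absurd h hfin
  have hFIN : FIN' ≠ τ := sup_ne (sup_ne (sup_ne_coe fun l _ => (h₂ l).2)
    (hS₂.maxPhase_ne pre_notMem_lastPhase)) (sup_ne_coe fun l _ => (h₂ l).1)
  have h₃ : ∀ l, (g₃ l).Unfinalized τ := by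
    intro l
    simp only [g₃, Function.update_apply]
    split_ifs
    · exact ⟨(h₂ i).1, hFIN⟩
    · exact h₂ l
  have hS₃ : CAS.Unfinalized τ S₃ := hS₂.updatePhase fun h => absurd h hFIN
  exact ⟨hS₃, ⟨hS₃.maxPhase_ne pre_notMem_finPhases, hS₃.maxPhase_ne pre_notMem_lastPhase⟩, h₃⟩

/-- The request does not finalize `τ`. -/
def Request.Unfinalized (τ : Tag N) : Request N A → Prop
  | .finalize _ t => t ≠ τ
  | .finalizeAgain t => t ≠ τ
  | _ => True

theorem Unfinalized.handle {τ : Tag N} {S : Finset (Record N A)} (h : Unfinalized τ S)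
    (w₀ : A) {q : Request N A} (hq : q.Unfinalized τ) : Unfinalized τ (handle S w₀ q).1 := by
  rcases q with (_ | _) | ⟨t, w⟩ | ⟨_ | _, _⟩ | _
  · exact h
  · exact h
  · exact h.updatePhase fun _ => rfl
  · exact h.updatePhase fun h => absurd h hq
  · exact h.updatePhase fun h => absurd h hq
  · exact h.updatePhase fun h => absurd (WithBot.coe_inj.1 h) hq

end Store

/-! ### The effect of a step on one node or wire -/

section Steps

variable {N k e : ℕ} {A : Type} {P : Params N k e A} {s s' : State N k A} {l : Label N k A}

theorem Step.client (h : Step P s l s') (i : Fin N) :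
    (s'.client i = s.client i ∧ s'.calls i = s.calls i) ∨
    (∃ j r, s'.client i = (s.client i).addAck j r ∧ s'.calls i = s.calls i ∧
      s.wire i j = .toClient (some (s.calls i, r))) ∨
    (l = .advance i ∧ ¬ (s.client i).Idle ∧ IsQuorum k e (ackSet (s.client i).acks) ∧
      s'.client i = (s.client i).advance P i ∧ s'.calls i = s.calls i + 1) ∨
    (∃ op, l = .invoke i op ∧ (s.client i).Idle ∧ s'.client i = .query op (fun _ => none) ∧
      s'.calls i = s.calls i + 1) := by
  cases h with
  | invoke i' op alive h =>
    by_cases hi : i' = i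
    · subst hi
      exact Or.inr (Or.inr (Or.inr ⟨op, rfl, h, by simp [State.newCall, State.setClient],
        by simp [State.newCall, State.setClient]⟩))
    · exact Or.inl (by simp [State.newCall, State.setClient, Ne.symm hi])
  | advance i' alive busy h =>
    by_cases hi : i' = i
    · subst hi
      exact Or.inr (Or.inr (Or.inl ⟨rfl, busy, h, by simp [State.newCall, State.setClient],
        by simp [State.newCall, State.setClient]⟩))
    · exact Or.inl (by simp [State.newCall, State.setClient, Ne.symm hi])
  | pongArrive i' j r alive h =>
    by_cases hi : i' = i
    · subst hi
      exact Or.inr (Or.inl ⟨j, r, by simp [State.setWire, State.setClient],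
        by simp [State.setWire, State.setClient], h⟩)
    · exact Or.inl (by simp [State.setWire, State.setClient, Ne.symm hi])
  | _ => exact Or.inl ⟨rfl, rfl⟩

theorem Step.server (h : Step P s l s') (j : Fin N) :
    s'.server j = s.server j ∨
    (∃ i, s.wire i j = .toServer none ∧ s'.server j =
      { s.server j with pongTx := Function.update (s.server j).pongTx i none }) ∨
    (∃ i n q r, s.wire i j = .toServer (some (n, q)) ∧
      MayReply P j (handle (s.server j).store (P.code P.v₀ j) q).2 r ∧ s'.server j =
      { s.server j with
        store := (handle (s.server j).store (P.code P.v₀ j) q).1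
        pongTx := Function.update (s.server j).pongTx i (some (n, r)) }) ∨
    (∃ i m, s.gossipWire i j = some m ∧ s'.server j = onGossip k e j i m (s.server j)) := by
  cases h with
  | pingArriveEmpty i j' alive h =>
    by_cases hj : j' = j
    · subst hj
      exact Or.inr (Or.inl ⟨i, h, by simp [State.setWire, State.setPong, State.setServer]⟩)
    · exact Or.inl (by simp [State.setWire, State.setPong, State.setServer, Ne.symm hj])
  | pingArrive i j' n q r alive h hr =>
    by_cases hj : j' = j
    · subst hj
      exact Or.inr (Or.inr (Or.inl ⟨i, n, q, r, h, hr,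
        by simp [State.setWire, State.setPong, State.setServer, State.setStore]⟩))
    · exact Or.inl
        (by simp [State.setWire, State.setPong, State.setServer, State.setStore, Ne.symm hj])
  | gossipArrive i j' m ne alive h =>
    by_cases hj : j' = j
    · subst hj
      exact Or.inr (Or.inr (Or.inr ⟨i, m, h, by simp [State.setGossipWire, State.setServer]⟩))
    · exact Or.inl (by simp [State.setGossipWire, State.setServer, Ne.symm hj])
  | _ => exact Or.inl rfl

theorem State.setWire_wire (s : State N k A) (i j i' j' : Fin N) (w : Wire N A) :
    (s.setWire i j w).wire i' j' = if i' = i ∧ j' = j then w else s.wire i' j' := by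
  by_cases hi : i' = i
  · subst hi
    by_cases hj : j' = j <;> simp [State.setWire, hj]
  · simp [State.setWire, hi]

theorem Step.wire (h : Step P s l s') (i j : Fin N) :
    s'.wire i j = s.wire i j ∨
    s'.wire i j = .toServer (((s.client i).request j).map fun q => (s.calls i, q)) ∨
    s'.wire i j = .atServer ∨
    s'.wire i j = .toClient ((s.server j).pongTx i) ∨
    s'.wire i j = .atClient := by
  cases h with
  | pingDepart i' j' alive h =>
    rw [State.setWire_wire]
    split_ifs with hij
    · obtain ⟨rfl, rfl⟩ := hij
      exact Or.inr (Or.inl rfl)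
    · exact Or.inl rfl
  | pingArriveEmpty i' j' alive h =>
    rw [State.setWire_wire]
    split_ifs with hij
    · exact Or.inr (Or.inr (Or.inl rfl))
    · exact Or.inl rfl
  | pingArrive i' j' n q r alive h hr =>
    rw [State.setWire_wire]
    split_ifs with hij
    · exact Or.inr (Or.inr (Or.inl rfl))
    · exact Or.inl rfl
  | pongDepart i' j' alive h =>
    rw [State.setWire_wire]
    split_ifs with hij
    · obtain ⟨rfl, rfl⟩ := hij
      exact Or.inr (Or.inr (Or.inr (Or.inl rfl)))
    · exact Or.inl rfl
  | pongArrive i' j' r alive h =>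
    rw [State.setWire_wire]
    split_ifs with hij
    · exact Or.inr (Or.inr (Or.inr (Or.inr rfl)))
    · exact Or.inl rfl
  | pongArriveOther i' j' m alive h hm =>
    rw [State.setWire_wire]
    split_ifs with hij
    · exact Or.inr (Or.inr (Or.inr (Or.inr rfl)))
    · exact Or.inl rfl
  | _ => exact Or.inl rfl

theorem State.setGossipWire_gossipWire (s : State N k A) (i j i' j' : Fin N)
    (m : Option (Gossip N)) :
    (s.setGossipWire i j m).gossipWire i' j' =
      if i' = i ∧ j' = j then m else s.gossipWire i' j' := by
  by_cases hi : i' = i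
  · subst hi
    by_cases hj : j' = j <;> simp [State.setGossipWire, hj]
  · simp [State.setGossipWire, hi]

theorem Step.gossipWire (h : Step P s l s') (i j : Fin N) :
    s'.gossipWire i j = s.gossipWire i j ∨ s'.gossipWire i j = some (s.server i).gossipTx ∨
    s'.gossipWire i j = none := by
  cases h with
  | gossipDepart i' j' ne alive h =>
    rw [State.setGossipWire_gossipWire]
    split_ifs with hij
    · obtain ⟨rfl, rfl⟩ := hij
      exact Or.inr (Or.inl rfl)
    · exact Or.inl rfl
  | gossipArrive i' j' m ne alive h =>
    rw [State.setGossipWire_gossipWire]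
    split_ifs with hij
    · exact Or.inr (Or.inr rfl)
    · exact Or.inl rfl
  | _ => exact Or.inl rfl

theorem Step.persists (h : Step P s l s') (j : Fin N) :
    Persists (s.server j).store (s'.server j).store := by
  rcases h.server j with h | ⟨i, -, h⟩ | ⟨i, n, q, r, -, -, h⟩ | ⟨i, m, -, h⟩ <;> rw [h]
  · exact Persists.refl _
  · exact Persists.refl _
  · exact persists_handle _ _ _
  · exact persists_onGossip _ _ _ _ _ _

/-! ### Requests and acknowledgments of the current call -/

theorem Client.request_addAck (c : Client N k A) (j j' : Fin N) (r : Reply N A) :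
    (c.addAck j r).request j' = c.request j' := by
  cases c <;> rfl

theorem Client.acks_addAck {c : Client N k A} {j j' : Fin N} {r r' : Reply N A}
    (h : (c.addAck j r).acks j' = some r') : (j' = j ∧ r' = r) ∨ c.acks j' = some r' := by
  by_cases hj : j' = j
  · subst hj
    cases c <;> simp_all [Client.addAck, Client.acks]
  · right
    cases c <;> simp_all [Client.addAck, Client.acks]

theorem Client.acks_advance (c : Client N k A) (i j : Fin N) : (c.advance P i).acks j = none := by
  cases c with
  | query op => cases op <;> rfl
  | _ => rfl

/-- A step either continues the current call of `qrmAccess` of a client, or starts a new call. -/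
theorem Step.call (h : Step P s l s') (i : Fin N) :
    (s'.calls i = s.calls i ∧ ∀ j, (s'.client i).request j = (s.client i).request j) ∨
    (s'.calls i = s.calls i + 1 ∧ ∀ j, (s'.client i).acks j = none) := by
  rcases h.client i with ⟨hc, hn⟩ | ⟨j, r, hc, hn, -⟩ | ⟨-, -, -, hc, hn⟩ | ⟨op, -, -, hc, hn⟩
  · exact Or.inl ⟨hn, fun _ => by rw [hc]⟩
  · exact Or.inl ⟨hn, fun _ => by rw [hc, Client.request_addAck]⟩
  · exact Or.inr ⟨hn, fun _ => by rw [hc, Client.acks_advance]⟩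
  · exact Or.inr ⟨hn, fun _ => by rw [hc]; rfl⟩

/-- Messages in transit belong to past calls or to the current one, and those requests that belong to
the current call are the ones that it asks for. -/
structure State.Fresh (s : State N k A) : Prop where
  request_le : ∀ i j n q, s.wire i j = .toServer (some (n, q)) → n ≤ s.calls i
  request_eq : ∀ i j q, s.wire i j = .toServer (some (s.calls i, q)) →
    (s.client i).request j = some q
  buffer_le : ∀ i j n r, (s.server j).pongTx i = some (n, r) → n ≤ s.calls i
  reply_le : ∀ i j n r, s.wire i j = .toClient (some (n, r)) → n ≤ s.calls i

theorem State.NoStaleMessages.fresh (h : s.NoStaleMessages) : s.Fresh where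
  request_le i j n q hw := by rcases h.1 i j with h | h | h | h <;> simp [hw] at h
  request_eq i j q hw := by rcases h.1 i j with h | h | h | h <;> simp [hw] at h
  buffer_le i j n r hw := by simp [h.2] at hw
  reply_le i j n r hw := by rcases h.1 i j with h | h | h | h <;> simp [hw] at h

theorem Step.calls_le (h : Step P s l s') (i : Fin N) : s.calls i ≤ s'.calls i := by
  rcases h.call i with h | h <;> omega

theorem Step.fresh (h : Step P s l s') (hs : s.Fresh) : s'.Fresh where
  request_le i j n q hw := by
    refine le_trans ?_ (h.calls_le i)
    rcases h.wire i j with h' | h' | h' | h' | h' <;> rw [h'] at hw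
    · exact hs.request_le i j n q hw
    · simp only [Wire.toServer.injEq, Option.map_eq_some_iff, Prod.mk.injEq] at hw
      obtain ⟨_, _, rfl, _⟩ := hw
      exact le_rfl
    all_goals cases hw
  request_eq i j q hw := by
    rcases h.wire i j with h' | h' | h' | h' | h' <;> rw [h'] at hw
    · have := hs.request_le i j _ q hw
      rcases h.call i with ⟨hn, hc⟩ | ⟨hn, -⟩
      · rw [hn] at hw
        rw [hc, hs.request_eq i j q hw]
      -- A request already in transit cannot bear the number of a call that starts in this very
      -- step.
      · omega
    · simp only [Wire.toServer.injEq, Option.map_eq_some_iff, Prod.mk.injEq] at hw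
      obtain ⟨q', hq', hn', rfl⟩ := hw
      rcases h.call i with ⟨hn, hc⟩ | ⟨hn, -⟩
      · rw [hc, hq']
      · omega
    all_goals cases hw
  buffer_le i j n r hw := by
    refine le_trans ?_ (h.calls_le i)
    rcases h.server j with h' | ⟨i', -, h'⟩ | ⟨i', n', q', r', hw', -, h'⟩ | ⟨i', m, -, h'⟩ <;>
      rw [h'] at hw
    · exact hs.buffer_le i j n r hw
    · simp only [Function.update_apply] at hw
      split_ifs at hw
      exact hs.buffer_le i j n r hw
    · simp only [Function.update_apply] at hw
      split_ifs at hw with hi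
      · cases hw
        subst hi
        exact hs.request_le _ _ _ _ hw'
      · exact hs.buffer_le i j n r hw
    · exact hs.buffer_le i j n r hw
  reply_le i j n r hw := by
    refine le_trans ?_ (h.calls_le i)
    rcases h.wire i j with h' | h' | h' | h' | h' <;> rw [h'] at hw
    · exact hs.reply_le i j n r hw
    · cases hw
    · cases hw
    · exact hs.buffer_le i j n r (Wire.toClient.inj hw)
    · cases hw

/-- The reply `r` of server `j` to the current call of client `i` has been received, is in transit,
or waits in the buffer of the server. -/
def State.Replied (s : State N k A) (i j : Fin N) (r : Reply N A) : Prop :=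
  (s.client i).acks j = some r ∨ (s.server j).pongTx i = some (s.calls i, r) ∨
    s.wire i j = .toClient (some (s.calls i, r))

/-- By freshness no existing message bears the number of a call that is only now being started, so a
reply to the current call shows that the step has not begun a new one. The reply then either existed
before or was produced by handling the request of this call. -/
theorem Step.replied (h : Step P s l s') (hs : s.Fresh) {i j : Fin N} {r : Reply N A}
    (hr : s'.Replied i j r) :
    (s'.calls i = s.calls i ∧ ∀ j, (s'.client i).request j = (s.client i).request j) ∧
    (s.Replied i j r ∨
      ∃ q, (s.client i).request j = some q ∧
        MayReply P j (handle (s.server j).store (P.code P.v₀ j) q).2 r ∧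
        (s'.server j).store = (handle (s.server j).store (P.code P.v₀ j) q).1) := by
  have hcall := h.call i
  rcases hr with hr | hr | hr
  · rcases hcall with hcall | ⟨-, hcall⟩
    · refine ⟨hcall, Or.inl ?_⟩
      rcases h.client i with ⟨hc, -⟩ | ⟨j', r', hc, -, hw⟩ | ⟨-, -, -, -, hn⟩ | ⟨op, -, -, -, hn⟩
      · exact Or.inl (hc ▸ hr)
      · rw [hc] at hr
        rcases Client.acks_addAck hr with ⟨rfl, rfl⟩ | hr
        · exact Or.inr (Or.inr hw)
        · exact Or.inl hr
      · omega
      · omega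
    · simp [hcall] at hr
  · rcases h.server j with h' | ⟨i', -, h'⟩ | ⟨i', n', q', r', hw', hr', h'⟩ | ⟨i', m, -, h'⟩
    · rw [h'] at hr
      have := hs.buffer_le i j _ r hr
      rcases hcall with hcall | ⟨hn, -⟩
      · exact ⟨hcall, Or.inl (Or.inr (Or.inl (hcall.1 ▸ hr)))⟩
      · omega
    · rw [h'] at hr
      simp only [Function.update_apply] at hr
      split_ifs at hr
      have := hs.buffer_le i j _ r hr
      rcases hcall with hcall | ⟨hn, -⟩
      · exact ⟨hcall, Or.inl (Or.inr (Or.inl (hcall.1 ▸ hr)))⟩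
      · omega
    · rw [h'] at hr
      simp only [Function.update_apply] at hr
      split_ifs at hr with hi
      · subst hi
        simp only [Option.some.injEq, Prod.mk.injEq] at hr
        obtain ⟨rfl, rfl⟩ := hr
        have := hs.request_le _ _ _ _ hw'
        rcases hcall with hcall | ⟨hn, -⟩
        · refine ⟨hcall, Or.inr ⟨q', hs.request_eq _ _ _ (hcall.1 ▸ hw'), hr', by rw [h']⟩⟩
        · omega
      · have := hs.buffer_le i j _ r hr
        rcases hcall with hcall | ⟨hn, -⟩
        · exact ⟨hcall, Or.inl (Or.inr (Or.inl (hcall.1 ▸ hr)))⟩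
        · omega
    · rw [h'] at hr
      have := hs.buffer_le i j _ r hr
      rcases hcall with hcall | ⟨hn, -⟩
      · exact ⟨hcall, Or.inl (Or.inr (Or.inl (hcall.1 ▸ hr)))⟩
      · omega
  · rcases h.wire i j with h' | h' | h' | h' | h' <;> rw [h'] at hr
    · have := hs.reply_le i j _ r hr
      rcases hcall with hcall | ⟨hn, -⟩
      · exact ⟨hcall, Or.inl (Or.inr (Or.inr (hcall.1 ▸ hr)))⟩
      · omega
    · cases hr
    · cases hr
    · have hr := Wire.toClient.inj hr
      have := hs.buffer_le i j _ r hr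
      rcases hcall with hcall | ⟨hn, -⟩
      · exact ⟨hcall, Or.inl (Or.inr (Or.inl (hcall.1 ▸ hr)))⟩
      · omega
    · cases hr

end Steps

/-! ### Histories -/

namespace Execution

variable {N k e : ℕ} {A : Type} {P : Params N k e A} (R : Execution P)

theorem calls_mono (i : Fin N) : Monotone fun n => (R.state n).calls i :=
  monotone_nat_of_le_succ fun n => (R.step n).calls_le i

theorem persists {m n : ℕ} (h : m ≤ n) (j : Fin N) :
    Persists ((R.state m).server j).store ((R.state n).server j).store := by
  induction n, h using Nat.le_induction with
  | base => exact Persists.refl _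
  | succ n _ ih => exact ih.trans ((R.step n).persists j)

variable {R}

theorem fresh (h : (R.state 0).Fresh) (n : ℕ) : (R.state n).Fresh := by
  induction n with
  | zero => exact h
  | succ n ih => exact (R.step n).fresh ih

/-- Call numbers never decrease, so equality at both ends forces them to be constant in between, and
requests change only together with the call number. -/
theorem request_eq_of_calls_eq {i : Fin N} {m n : ℕ} (hmn : m ≤ n)
    (h : (R.state m).calls i = (R.state n).calls i) (j : Fin N) :
    ((R.state n).client i).request j = ((R.state m).client i).request j := by
  induction n, hmn using Nat.le_induction with
  | base => rfl
  | succ n hmn ih =>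
    have h₁ := R.calls_mono i hmn
    dsimp only at h₁
    rcases (R.step n).call i with ⟨hn, hc⟩ | ⟨hn, -⟩
    · rw [hc, ih (by omega)]
    · omega

/-- If the current call of a client has been started after state `m`, then each of its
acknowledgments comes from a server that has handled the request after state `m`. -/
theorem exists_handled (hR : (R.state 0).Fresh) {i : Fin N} {m n : ℕ} (hmn : m ≤ n)
    (hcalls : (R.state m).calls i ≠ (R.state n).calls i) {j : Fin N} {r : Reply N A}
    (hr : (R.state n).Replied i j r) :
    ∃ p q, m < p ∧ p < n ∧ ((R.state n).client i).request j = some q ∧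
      MayReply P j (handle ((R.state p).server j).store (P.code P.v₀ j) q).2 r ∧
      ((R.state (p + 1)).server j).store =
        (handle ((R.state p).server j).store (P.code P.v₀ j) q).1 := by
  induction n, hmn using Nat.le_induction with
  | base => exact absurd rfl hcalls
  | succ n hmn ih =>
    obtain ⟨⟨hn, hq⟩, h⟩ := (R.step n).replied (fresh hR n) hr
    rw [hn] at hcalls
    rcases h with h | ⟨q, hq', h₁, h₂⟩
    · obtain ⟨p, q, h₁, h₂, h₃, h₄⟩ := ih hcalls h
      exact ⟨p, q, h₁, by omega, by rw [hq, h₃], h₄⟩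
    · refine ⟨n, q, lt_of_le_of_ne hmn ?_, by omega, by rw [hq, hq'], h₁, h₂⟩
      rintro rfl
      exact hcalls rfl

end Execution

/-! ### The coded elements and the phases of one tag -/

section Invariants

variable {N k e : ℕ} {A : Type} {P : Params N k e A} {s s' : State N k A} {l : Label N k A}

theorem Step.of_advance {i : Fin N} (h : Step P s (.advance i) s') :
    ¬ (s.client i).Idle ∧ IsQuorum k e (ackSet (s.client i).acks) ∧
      s'.client i = (s.client i).advance P i ∧ s'.calls i = s.calls i + 1 := by
  cases h with
  | advance _ alive busy h =>
    exact ⟨busy, h, by simp [State.newCall, State.setClient],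
      by simp [State.newCall, State.setClient]⟩

theorem mem_ackSet {a : Acks N A} {j : Fin N} : j ∈ ackSet a ↔ ∃ r, a j = some r := by
  simp [ackSet, Option.isSome_iff_exists]

theorem le_maxTag {a : Acks N A} {j : Fin N} {r : Reply N A} (h : a j = some r) :
    r.tag ≤ maxTag a := by
  have : ((a j).map Reply.tag).getD ⊥ ≤ maxTag a :=
    Finset.le_sup (f := fun j => ((a j).map Reply.tag).getD ⊥) (Finset.mem_univ j)
  rwa [h] at this

theorem maxTag_ne {a : Acks N A} {τ : Tag N} (h : ∀ j r, a j = some r → r.tag ≠ τ) :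
    maxTag a ≠ τ := by
  refine sup_ne_coe fun j _ => ?_
  rcases ha : a j with _ | r
  · simp
  · simpa using h j r ha

/-- The tag `τ` occurs only in phase `pre`, or in messages that cannot finalize it. -/
structure State.Unfinalized (τ : Tag N) (s : State N k A) : Prop where
  server : ∀ j, (s.server j).Unfinalized τ
  gossip : ∀ i j g, s.gossipWire i j = some g → g.Unfinalized τ
  wire : ∀ i j n q, s.wire i j = .toServer (some (n, q)) → q.Unfinalized τ
  client : ∀ i j q, (s.client i).request j = some q → q.Unfinalized τ
  reply : ∀ i j r, (s.client i).request j = some (.query .reader) → s.Replied i j r → r.tag ≠ τ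

/-- A finalization of `τ` can originate only from a writer that completes its pre-write phase, which
`hp` excludes, or from a reader that has been told `τ` by a server. The latter report only finalized
tags, which is why the invariant also tracks replies to reader queries. -/
theorem Step.unfinalized (h : Step P s l s') (hs : s.Fresh) {τ : Tag N} (hu : s.Unfinalized τ)
    (hp : ∀ i words acks, l = .advance i → s.client i ≠ .prewrite τ words acks) :
    s'.Unfinalized τ where
  server j := by
    rcases h.server j with h' | ⟨i', -, h'⟩ | ⟨i', n', q', r', hw', -, h'⟩ | ⟨i', m, hm, h'⟩ <;>
      rw [h']
    · exact hu.server j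
    · exact hu.server j
    · exact ⟨(hu.server j).1.handle _ (hu.wire _ _ _ _ hw'), (hu.server j).2⟩
    · exact (hu.server j).onGossip _ _ _ _ (hu.gossip _ _ _ hm)
  gossip i j g hg := by
    rcases h.gossipWire i j with h' | h' | h' <;> rw [h'] at hg
    · exact hu.gossip i j g hg
    · cases hg
      exact (hu.server i).2.1
    · cases hg
  wire i j n q hw := by
    rcases h.wire i j with h' | h' | h' | h' | h' <;> rw [h'] at hw
    · exact hu.wire i j n q hw
    · simp only [Wire.toServer.injEq, Option.map_eq_some_iff, Prod.mk.injEq] at hw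
      obtain ⟨q', hq', -, rfl⟩ := hw
      exact hu.client i j q' hq'
    all_goals cases hw
  client i j q hq := by
    rcases h.client i with ⟨hc, -⟩ | ⟨j', r', hc, -, -⟩ | ⟨hl, -, -, hc, -⟩ | ⟨op, -, -, hc, -⟩ <;>
      rw [hc] at hq
    · exact hu.client i j q hq
    · rw [Client.request_addAck] at hq
      exact hu.client i j q hq
    · rcases hcl : s.client i with out | ⟨_ | v, a⟩ | ⟨t, ws, a⟩ | ⟨t, a⟩ | ⟨t, a⟩ | ⟨t, a⟩ <;>
        rw [hcl] at hq <;> cases hq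
      -- A reader enters its finalize phase with the largest tag reported to it, and none of the
      -- reported tags is `τ`.
      · refine maxTag_ne fun j' r hr => hu.reply i j' r (by rw [hcl]; rfl) (Or.inl ?_)
        rw [hcl]
        exact hr
      · trivial
      · intro ht
        rw [WithBot.coe_inj.1 ht] at hcl
        exact hp i ws a hl hcl
      · have := hu.client i j (.finalize .writer t) (by rw [hcl]; rfl)
        exact fun ht => this (congrArg _ ht)
    · cases hq
      trivial
  reply i j r hq hr := by
    obtain ⟨⟨-, hc⟩, hr | ⟨q, hq', hr', -⟩⟩ := h.replied hs hr
    · exact hu.reply i j r (hc j ▸ hq) hr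
    · rw [hc, hq'] at hq
      cases hq
      -- A malicious server falsifies only the data field, so the tag of the reply is still the
      -- largest finalized tag of its storage.
      rw [hr'.1]
      exact (hu.server j).1.maxPhase_ne pre_notMem_finPhases

/-- All coded elements for the tag `τ` are those of `v`, and only the client to which `τ` belongs
pre-writes it. -/
structure State.Carries (P : Params N k e A) (τ : Tag N) (v : Fin k → A) (s : State N k A) :
    Prop where
  store : ∀ j, OnlyWord τ (P.code v j) (s.server j).store
  wire : ∀ i j n w, s.wire i j = .toServer (some (n, .prewrite τ w)) → w = some (P.code v j)
  client : ∀ i words acks, s.client i = .prewrite τ words acks →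
    i = (ofLex τ).2 ∧ words = fun j => some (P.code v j)

theorem Client.eq_prewrite_of_addAck {c : Client N k A} {j : Fin N} {r : Reply N A} {τ : Tag N}
    {words : Fin N → Option A} {acks : Acks N A} (h : c.addAck j r = .prewrite τ words acks) :
    ∃ acks', c = .prewrite τ words acks' := by
  cases c <;> cases h
  exact ⟨_, rfl⟩

theorem Client.eq_query_of_advance {c : Client N k A} {i : Fin N} {τ : Tag N}
    {words : Fin N → Option A} {acks : Acks N A} (h : c.advance P i = .prewrite τ words acks) :
    ∃ v acks', c = .query (.write v) acks' ∧ nextTag (maxTag acks') i = τ ∧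
      words = fun j => some (P.code v j) := by
  rcases c with out | ⟨_ | v, a⟩ | ⟨t, ws, a⟩ | ⟨t, a⟩ | ⟨t, a⟩ | ⟨t, a⟩ <;> cases h
  exact ⟨v, a, rfl, rfl, rfl⟩

/-- The step makes a writer with the value `v` start to pre-write with the tag `τ`. -/
def Creates (s : State N k A) (l : Label N k A) (τ : Tag N) (v : Fin k → A) : Prop :=
  ∃ i acks, l = .advance i ∧ s.client i = .query (.write v) acks ∧ nextTag (maxTag acks) i = τ

theorem Creates.unique {τ : Tag N} {v v' : Fin k → A} (h : Creates s l τ v)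
    (h' : Creates s l τ v') : v = v' := by
  obtain ⟨i, acks, rfl, hc, -⟩ := h
  obtain ⟨i', acks', hl, hc', -⟩ := h'
  cases hl
  rw [hc] at hc'
  cases hc'
  rfl

theorem Step.eq_prewrite (h : Step P s l s') {i : Fin N} {τ : Tag N} {words : Fin N → Option A}
    {acks : Acks N A} (hc : s'.client i = .prewrite τ words acks) :
    (∃ acks', s.client i = .prewrite τ words acks') ∨
    ∃ v, Creates s l τ v ∧ i = (ofLex τ).2 ∧ words = fun j => some (P.code v j) := by
  rcases h.client i with ⟨h', -⟩ | ⟨j', r', h', -, -⟩ | ⟨hl, -, -, h', -⟩ | ⟨op, -, -, h', -⟩ <;>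
    rw [h'] at hc
  · exact Or.inl ⟨acks, hc⟩
  · exact Or.inl (Client.eq_prewrite_of_addAck hc)
  · obtain ⟨v, acks', h₁, h₂, h₃⟩ := Client.eq_query_of_advance hc
    exact Or.inr ⟨v, ⟨i, acks', hl, h₁, h₂⟩, by rw [← h₂, nextTag_snd], h₃⟩
  · cases hc

/-- Coded elements enter a storage only through pre-write requests, these come only from pre-writing
clients, and a client starts to pre-write `τ` only in a creating step, which `hn` controls. -/
theorem Step.carries (h : Step P s l s') {τ : Tag N} {v : Fin k → A} (hv : s.Carries P τ v)
    (hn : ∀ v', Creates s l τ v' → v' = v) : s'.Carries P τ v where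
  store j := by
    rcases h.server j with h' | ⟨i', -, h'⟩ | ⟨i', n', q', r', hw', -, h'⟩ | ⟨i', m, hm, h'⟩ <;>
      rw [h']
    · exact hv.store j
    · exact hv.store j
    · refine (hv.store j).handle _ fun w hw => ?_
      subst hw
      exact hv.wire _ _ _ _ hw'
    · exact (hv.store j).onGossip _ _ _ _ _
  wire i j n w hw := by
    rcases h.wire i j with h' | h' | h' | h' | h' <;> rw [h'] at hw
    · exact hv.wire i j n w hw
    · simp only [Wire.toServer.injEq, Option.map_eq_some_iff, Prod.mk.injEq] at hw
      obtain ⟨q', hq', -, rfl⟩ := hw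
      rcases hcl : s.client i with out | ⟨op, a⟩ | ⟨t, ws, a⟩ | ⟨t, a⟩ | ⟨t, a⟩ | ⟨t, a⟩ <;>
        rw [hcl] at hq' <;> cases hq'
      rw [(hv.client _ _ _ hcl).2]
    all_goals cases hw
  client i words acks hc := by
    rcases h.eq_prewrite hc with ⟨acks', h'⟩ | ⟨v', h₁, h₂, h₃⟩
    · exact hv.client _ _ _ h'
    · rw [← hn v' h₁]
      exact ⟨h₂, h₃⟩

/-- The tag `τ` has not been finalized, and no coded element is known for it. -/
structure State.Unused (P : Params N k e A) (τ : Tag N) (s : State N k A) : Prop where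
  unfinalized : s.Unfinalized τ
  carries : ∀ v, s.Carries P τ v
  client : ∀ i words acks, s.client i ≠ .prewrite τ words acks

/-- Absence makes each clause about `τ` vacuous; in particular `Carries` holds for every value, so
that the value can be fixed later, when a writer creates `τ`. -/
theorem State.unused_of_not_hasTag {τ : Tag N} (h : ¬ s.HasTag τ) : s.Unused P τ := by
  simp only [State.HasTag, not_or, not_exists, not_and] at h
  obtain ⟨hc, hs, hw, hg⟩ := h
  have hreq : ∀ i j q, (s.client i).request j = some q → ¬ q.HasTag τ :=
    fun i j q hq hτ => hc i (Or.inl ⟨j, q, hq, hτ⟩)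
  have hacks : ∀ i j r, (s.client i).acks j = some r → r.tag ≠ τ :=
    fun i j r hr hτ => hc i (Or.inr ⟨j, r, hr, hτ⟩)
  have hstore : ∀ j, ∀ r ∈ (s.server j).store, r.tag ≠ τ :=
    fun j r hr hτ => hs j (Or.inl ⟨r, hr, hτ⟩)
  have hgossip : ∀ g : Gossip N, ¬ g.HasTag τ → g.Unfinalized τ :=
    fun g hg => ⟨fun h => hg (Or.inr (Or.inl h)), fun h => hg (Or.inr (Or.inr h))⟩
  have hrequest : ∀ q : Request N A, ¬ q.HasTag τ → q.Unfinalized τ := by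
    intro q hq
    cases q with
    | query => trivial
    | prewrite => trivial
    | finalize => exact hq
    | finalizeAgain => exact hq
  have hwire : ∀ i j n q, s.wire i j = .toServer (some (n, q)) → ¬ q.HasTag τ := by
    intro i j n q h hτ
    refine hw i j ?_
    rw [h]
    exact ⟨n, q, rfl, hτ⟩
  have hclient : ∀ i words acks, s.client i ≠ .prewrite τ words acks :=
    fun i words acks h => hreq i i (.prewrite τ (words i)) (by rw [h]; rfl) rfl
  refine ⟨⟨?_, ?_, ?_, ?_, ?_⟩, fun v => ⟨?_, ?_, ?_⟩, hclient⟩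
  · exact fun j => ⟨fun r hr hτ => absurd hτ (hstore j r hr),
      hgossip _ fun h => hs j (Or.inr (Or.inl h)),
      fun l => hgossip _ fun h => hs j (Or.inr (Or.inr (Or.inl ⟨l, h⟩)))⟩
  · exact fun i j g h => hgossip g (hg i j g h)
  · exact fun i j n q h => hrequest q (hwire i j n q h)
  · exact fun i j q h => hrequest q (hreq i j q h)
  · rintro i j r - (hr | hr | hr) hτ
    · exact hacks i j r hr hτ
    · exact hs j (Or.inr (Or.inr (Or.inr ⟨i, _, r, hr, hτ⟩)))
    · refine hw i j ?_
      rw [hr]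
      exact ⟨_, r, rfl, hτ⟩
  · exact fun j r hr hτ => absurd hτ (hstore j r hr)
  · exact fun i j n w h => absurd rfl (hwire i j n _ h)
  · exact fun i words acks h => absurd h (hclient i words acks)

theorem State.Safe.not_hasTag (h : s.Safe) (τ : Tag N) : ¬ s.HasTag τ := by
  obtain ⟨⟨hw, hp⟩, hc, hg, hs⟩ := h
  have hd : ¬ (Gossip.default : Gossip N).HasTag τ := by
    rintro (h | h | h) <;> exact absurd h WithBot.bot_ne_coe
  rintro (⟨i, h⟩ | ⟨j, h⟩ | ⟨i, j, h⟩ | ⟨i, j, g, h, hτ⟩)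
  · have hi := hc i
    rcases hcl : s.client i with out | _ | _ | _ | _ | _ <;> rw [hcl] at hi h
    · rcases h with ⟨j, q, h, -⟩ | ⟨j, r, h, -⟩ <;> cases h
    all_goals exact hi
  · rcases h with ⟨r, hr, -⟩ | h | ⟨l, h⟩ | ⟨i, n, r, h, -⟩
    · simp [(hs j).1] at hr
    · rw [(hs j).2.1] at h
      exact hd h
    · rw [(hs j).2.2] at h
      exact hd h
    · simp [hp] at h
  · rcases hw i j with h' | h' | h' | h' <;> rw [h'] at h
    · exact h
    · obtain ⟨n, q, h, -⟩ := h
      cases h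
    · exact h
    · obtain ⟨n, q, h, -⟩ := h
      cases h
  · rcases hg i j with h' | h' <;> rw [h'] at h <;> cases h
    exact hd hτ

end Invariants

/-! ### Lifetime of a tag: creation, pre-write, finalization -/

namespace Execution

variable {N k e : ℕ} {A : Type} {P : Params N k e A} {R : Execution P}

theorem IsVersion.mono {m n : ℕ} (hmn : m ≤ n) {t : Tag₀ N} {v : Fin k → A}
    (h : R.IsVersion m t v) : R.IsVersion n t v := by
  rcases h with h | ⟨p, hp, h⟩
  · exact Or.inl h
  · exact Or.inr ⟨p, hp.trans hmn, h⟩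

/-- By state `n` a quorum of servers has stored coded elements for `τ`, and the writer to which `τ`
belongs has then been in a phase other than its query phase. -/
def PreWritten (R : Execution P) (τ : Tag N) (n : ℕ) : Prop :=
  ∃ p ≤ n, ∃ Q, IsQuorum k e Q ∧
    (∀ j ∈ Q, ∃ r ∈ ((R.state p).server j).store, r.tag = τ ∧ r.word ≠ none) ∧
    ∀ j, ((R.state p).client (ofLex τ).2).request j ≠ some (.query .writer)

theorem PreWritten.mono {m n : ℕ} (hmn : m ≤ n) {τ : Tag N} (h : R.PreWritten τ m) :
    R.PreWritten τ n := by
  obtain ⟨p, hp, h⟩ := h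
  exact ⟨p, hp.trans hmn, h⟩

/-- The query of a creating writer would be answered by a server of the pre-write quorum that
already holds a record for `τ`. The writer would then choose a tag strictly larger than `τ`. -/
theorem PreWritten.not_creates (hk : 1 ≤ k) (hR : (R.state 0).Fresh) {τ : Tag N} {n : ℕ}
    (h : R.PreWritten τ n) (v : Fin k → A) : ¬ Creates (R.state n) (R.label n) τ v := by
  rintro ⟨i, acks, hl, hc, rfl⟩
  obtain ⟨p, hp, Q, hQ, hQs, hq⟩ := h
  rw [nextTag_snd] at hq
  -- The owner of `τ` was not in a writer's query at state `p`, so the query that ends now began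
  -- later and its answers reflect storages after `p`.
  have hcalls : (R.state p).calls i ≠ (R.state n).calls i := by
    intro h
    refine hq i ?_
    rw [← request_eq_of_calls_eq hp h, hc]
    rfl
  obtain ⟨-, hQ', -⟩ := (hl ▸ R.step n).of_advance
  rw [hc] at hQ'
  obtain ⟨j, hj, hj'⟩ := hQ.exists_common hk hQ'
  obtain ⟨r, hr⟩ := mem_ackSet.1 hj'
  obtain ⟨p', q, hp', -, hq', hr', -⟩ := exists_handled (r := r) hR hp hcalls
    (Or.inl (by rw [hc]; exact hr))
  rw [hc] at hq'
  cases hq'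
  obtain ⟨x, hx, hxt, -⟩ := hQs j hj
  obtain ⟨x', hx', hxt', -⟩ := R.persists hp'.le j x hx
  have h₁ := le_maxPhase hx' (mem_allPhases _)
  rw [hxt', hxt] at h₁
  have h₂ := le_maxTag hr
  rw [hr'.1] at h₂
  exact absurd (lt_of_lt_of_le (lt_nextTag _ i) (h₁.trans h₂)) (lt_irrefl _)

theorem PreWritten.carries (hk : 1 ≤ k) (hR : (R.state 0).Fresh) {τ : Tag N} {v : Fin k → A}
    {m n : ℕ} (hmn : m ≤ n) (h : R.PreWritten τ m) (hv : (R.state m).Carries P τ v) :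
    (R.state n).Carries P τ v := by
  induction n, hmn using Nat.le_induction with
  | base => exact hv
  | succ n hmn ih =>
    exact (R.step n).carries ih fun v' hv' => absurd hv' ((h.mono hmn).not_creates hk hR v')

/-- The acknowledging quorum serves as witness. `hcalls` guarantees that the pre-write call began
during the execution, so its acknowledgments are genuine, and `hv` that the words sent are coded
elements rather than `⊥`. -/
theorem preWritten_of_advance (hR : (R.state 0).Fresh) {τ : Tag N} {v : Fin k → A} {m n : ℕ}
    (hmn : m ≤ n)
    (hcalls : (R.state m).calls (ofLex τ).2 ≠ (R.state n).calls (ofLex τ).2)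
    {words : Fin N → Option A} {acks : Acks N A}
    (hc : (R.state n).client (ofLex τ).2 = .prewrite τ words acks)
    (hv : (R.state n).Carries P τ v) (hl : R.label n = .advance (ofLex τ).2) :
    R.PreWritten τ (n + 1) := by
  obtain ⟨-, hQ, hc', -⟩ := (hl ▸ R.step n).of_advance
  rw [hc] at hQ hc'
  refine ⟨n + 1, le_rfl, _, hQ, fun j hj => ?_, fun j => by rw [hc']; simp [Client.advance,
    Client.request]⟩
  obtain ⟨r, hr⟩ := mem_ackSet.1 hj
  obtain ⟨p, q, -, hp, hq, -, hs⟩ := exists_handled (r := r) hR hmn hcalls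
    (Or.inl (by rw [hc]; exact hr))
  rw [hc, (hv.client _ _ _ hc).2] at hq
  cases hq
  obtain ⟨x, hx, hxt, hxw⟩ := exists_mem_updatePhase_word
    ((R.state p).server j).store τ (P.code v j) .pre
  have hs' : x ∈ ((R.state (p + 1)).server j).store := by
    rw [hs]
    exact hx
  obtain ⟨x', hx', hxt', hxw', -⟩ := R.persists (show p + 1 ≤ n + 1 by omega) j x hs'
  exact ⟨x', hx', hxt'.trans hxt, hxw' hxw⟩

/-- A tag that is unused in some state remains so until some writer starts to pre-write with it, and it
is not finalized before that writer has completed its pre-write phase. -/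
theorem unused_or_carries (hk : 1 ≤ k) (hR : (R.state 0).Fresh) {τ : Tag N} {m n : ℕ}
    (hm : (R.state m).Unused P τ) (hmn : m ≤ n) :
    (R.state n).Unused P τ ∨
    ∃ v, R.IsVersion n τ v ∧ (R.state n).Carries P τ v ∧
      (((R.state n).Unfinalized τ ∧
        (∃ p ≤ n, (R.state p).calls (ofLex τ).2 ≠ (R.state n).calls (ofLex τ).2) ∧
        ∃ words acks, (R.state n).client (ofLex τ).2 = .prewrite τ words acks) ∨
      R.PreWritten τ n) := by
  induction n, hmn using Nat.le_induction with
  | base => exact Or.inl hm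
  | succ n hmn ih =>
    have hstep := R.step n
    rcases ih with hu | ⟨v, hver, hv, ⟨hu, ⟨p, hp, hcalls⟩, words, acks, hc⟩ | hw⟩
    · have hu' : (R.state (n + 1)).Unfinalized τ :=
        hstep.unfinalized (fresh hR n) hu.unfinalized fun i words acks _ => hu.client i words acks
      by_cases hcr : ∃ v, Creates (R.state n) (R.label n) τ v
      · obtain ⟨v, hv⟩ := hcr
        obtain ⟨i, acks, hl, hc, ht⟩ := id hv
        obtain ⟨-, -, hc', hn⟩ := (hl ▸ hstep).of_advance
        rw [hc] at hc'
        change _ = Client.prewrite (nextTag (maxTag acks) i) _ _ at hc'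
        obtain rfl : i = (ofLex τ).2 := by rw [← ht, nextTag_snd]
        rw [ht] at hc'
        -- State `n` witnesses the change of call number, since creating `τ` has just started a new
        -- call.
        exact Or.inr ⟨v, Or.inr ⟨n + 1, le_rfl, _, τ, _, rfl, hc'⟩,
          hstep.carries (hu.carries v) fun v' hv' => hv'.unique hv,
          Or.inl ⟨hu', ⟨n, by omega, by omega⟩, _, _, hc'⟩⟩
      · refine Or.inl ⟨hu', fun v => hstep.carries (hu.carries v) fun v' hv' =>
          absurd ⟨v', hv'⟩ hcr, fun i words acks hc => ?_⟩
        rcases hstep.eq_prewrite hc with ⟨acks', h⟩ | ⟨v, h, -⟩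
        · exact hu.client _ _ _ h
        · exact hcr ⟨v, h⟩
    · have hv' : (R.state (n + 1)).Carries P τ v := by
        refine hstep.carries hv ?_
        rintro v' ⟨i, acks', -, hc', ht⟩
        -- A second creator would have to be the owner of `τ`, but the owner is pre-writing and not
        -- in a query.
        obtain rfl : i = (ofLex τ).2 := by rw [← ht, nextTag_snd]
        rw [hc] at hc'
        cases hc'
      refine Or.inr ⟨v, hver.mono (by omega), hv', ?_⟩
      by_cases hl : R.label n = .advance (ofLex τ).2
      · exact Or.inr (preWritten_of_advance hR hp hcalls hc hv hl)
      · left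
        refine ⟨hstep.unfinalized (fresh hR n) hu ?_, ?_⟩
        · intro i words' acks' hl' hc'
          rw [(hv.client _ _ _ hc').1] at hl'
          exact hl hl'
        · rcases hstep.client (ofLex τ).2 with
            ⟨hc', hn⟩ | ⟨j, r, hc', hn, -⟩ | ⟨h, -⟩ | ⟨op, -, h, -⟩
          · exact ⟨⟨p, by omega, by rwa [hn]⟩, words, acks, hc'.trans hc⟩
          · exact ⟨⟨p, by omega, by rwa [hn]⟩, words, _, by rw [hc', hc]; rfl⟩
          · exact absurd h hl
          · rw [hc] at h
            exact h.elim
    · exact Or.inr ⟨v, hver.mono (by omega), hw.carries hk hR (Nat.le_succ n) hv,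
        Or.inr (hw.mono (by omega))⟩

theorem exists_version (hk : 1 ≤ k) (hR : (R.state 0).Fresh) {τ : Tag N} {m n : ℕ}
    (hm : ¬ (R.state m).HasTag τ) (hmn : m ≤ n) (hn : ¬ (R.state n).Unfinalized τ) :
    ∃ v, R.IsVersion n τ v ∧ (R.state n).Carries P τ v ∧ R.PreWritten τ n := by
  rcases unused_or_carries hk hR (State.unused_of_not_hasTag hm) hmn with
    h | ⟨v, h₁, h₂, ⟨h, -⟩ | h⟩
  · exact absurd h.unfinalized hn
  · exact absurd h hn
  · exact ⟨v, h₁, h₂, h⟩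

end Execution

/-! ### Counting correct coded elements among the replies -/

section Counting

variable {N k e : ℕ} {A : Type}

theorem ackWord_of_tag_eq {t : Tag₀ N} {a : Acks N A} {j : Fin N} {r : Reply N A}
    (h : a j = some r) (ht : r.tag = t) : ackWord t a j = r.word := by
  simp [ackWord, h, ht]

theorem card_received_le {Φ : (Fin k → A) → Fin N → A} {ws : Fin N → Option A} {v : Fin k → A}
    {M : Finset (Fin N)} (hM : M.card ≤ e)
    (h : ∀ j ∉ M, ws j = none ∨ ws j = some (Φ v j)) :
    (received ws).card ≤ (matching Φ ws v).card + e := by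
  classical
  have hs : received ws ⊆ matching Φ ws v ∪ M := by
    intro j hj
    by_cases hjM : j ∈ M
    · exact Finset.mem_union_right _ hjM
    · refine Finset.mem_union_left _ ?_
      simp only [received, matching, Finset.mem_filter, Finset.mem_univ, true_and] at hj ⊢
      rcases h j hjM with h | h
      · simp [h] at hj
      · exact h
  have := Finset.card_le_card hs
  have := Finset.card_union_le (matching Φ ws v) M
  omega

end Counting

/-! ### Start and end of an operation -/

section OperationSteps

variable {N k e : ℕ} {A : Type} {P : Params N k e A} {s s' : State N k A} {l : Label N k A}

theorem Step.of_invoke {i : Fin N} {op : Op k A} (h : Step P s (.invoke i op) s') :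
    s'.client i = .query op (fun _ => none) ∧ s'.calls i = s.calls i + 1 := by
  cases h with
  | invoke _ _ alive h => simp [State.newCall, State.setClient]

theorem Client.idle_addAck {c : Client N k A} {j : Fin N} {r : Reply N A} :
    (c.addAck j r).Idle ↔ c.Idle := by
  cases c <;> rfl

/-- A client that ends its procedure does so because its current call has returned. -/
theorem Step.of_return (h : Step P s l s') {i : Fin N} (hb : ¬ (s.client i).Idle)
    (hi : (s'.client i).Idle) :
    IsQuorum k e (ackSet (s.client i).acks) ∧ s'.client i = (s.client i).advance P i := by
  rcases h.client i with ⟨h', -⟩ | ⟨j, r, h', -, -⟩ | ⟨-, -, hQ, h', -⟩ | ⟨op, -, -, h', -⟩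
  · rw [h'] at hi
    exact absurd hi hb
  · rw [h', Client.idle_addAck] at hi
    exact absurd hi hb
  · exact ⟨hQ, h'⟩
  · rw [h'] at hi
    exact hi.elim

end OperationSteps

/-! ### Phases of operations and correctness of reads -/

namespace Execution

variable {N k e : ℕ} {A : Type} {P : Params N k e A} {R : Execution P}

theorem calls_ne_of_invoke {i : Fin N} {op : Op k A} {a n : ℕ} (ha : R.label a = .invoke i op)
    (han : a < n) : (R.state a).calls i ≠ (R.state n).calls i := by
  have h₁ := (ha ▸ R.step a).of_invoke.2
  have h₂ := R.calls_mono i (Nat.succ_le_of_lt han)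
  dsimp only [Nat.succ_eq_add_one] at h₂
  omega

/-- The phases of a read operation. -/
theorem CompleteOp.read_phases {i : Fin N} {a b n : ℕ} (h : R.CompleteOp i .read a b)
    (han : a < n) (hnb : n ≤ b) :
    (∃ acks, (R.state n).client i = .query .read acks) ∨
    ∃ c acks₀ acks, a < c ∧ c < n ∧ (R.state c).client i = .query .read acks₀ ∧
      IsQuorum k e (ackSet acks₀) ∧
      (R.state (c + 1)).client i = .finalizeR (maxTag acks₀) (fun _ => none) ∧
      (R.state n).client i = .finalizeR (maxTag acks₀) acks := by
  obtain ⟨-, ha, hbusy, -⟩ := h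
  induction n, (Nat.succ_le_of_lt han) using Nat.le_induction with
  | base => exact Or.inl ⟨_, (ha ▸ R.step a).of_invoke.1⟩
  | succ n hn ih =>
    have hidle := hbusy (n + 1) han hnb
    have hidle' := hbusy n (by omega) (by omega)
    rcases (R.step n).client i with
      ⟨h', -⟩ | ⟨j, r, h', -, -⟩ | ⟨-, -, hQ, h', -⟩ | ⟨op, -, h', -, -⟩
    · rcases ih (by omega) (by omega) with ⟨acks, h⟩ | ⟨c, acks₀, acks, h₁, h₂, h₃, h₄, h₅, h⟩
      · exact Or.inl ⟨acks, h'.trans h⟩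
      · exact Or.inr ⟨c, acks₀, acks, h₁, by omega, h₃, h₄, h₅, h'.trans h⟩
    · rcases ih (by omega) (by omega) with ⟨acks, h⟩ | ⟨c, acks₀, acks, h₁, h₂, h₃, h₄, h₅, h⟩
      · exact Or.inl ⟨_, by rw [h', h]; rfl⟩
      · exact Or.inr ⟨c, acks₀, _, h₁, by omega, h₃, h₄, h₅, by rw [h', h]; rfl⟩
    · rcases ih (by omega) (by omega) with ⟨acks, h⟩ | ⟨c, acks₀, acks, h₁, h₂, h₃, h₄, h₅, h⟩
      · rw [h] at hQ h'
        exact Or.inr ⟨n, acks, _, by omega, by omega, h, hQ, h', h'⟩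
      · rw [h', h] at hidle
        exact absurd trivial hidle
    · exact absurd h' hidle'

/-- A writer reaches its last phase only after a quorum has acknowledged its finalize phase. -/
theorem CompleteOp.write_phases {i : Fin N} {v : Fin k → A} {a b n : ℕ}
    (h : R.CompleteOp i (.write v) a b) (han : a < n) (hnb : n ≤ b) {t : Tag N} {acks : Acks N A}
    (hc : (R.state n).client i = .finalizeAgainW t acks) :
    ∃ c acks₀, a < c ∧ c < n ∧ (R.state c).client i = .finalizeW t acks₀ ∧
      IsQuorum k e (ackSet acks₀) := by
  obtain ⟨-, ha, hbusy, -⟩ := h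
  induction n, (Nat.succ_le_of_lt han) using Nat.le_induction generalizing acks with
  | base =>
    have hc' := (ha ▸ R.step a).of_invoke.1
    exact absurd (hc'.symm.trans hc) (by simp)
  | succ n hn ih =>
    rcases (R.step n).client i with
      ⟨h', -⟩ | ⟨j, r, h', -, -⟩ | ⟨-, -, hQ, h', -⟩ | ⟨op, -, -, h', -⟩
    · obtain ⟨c, acks₀, h₁, h₂, h⟩ := ih (by omega) (by omega) (h'.symm.trans hc)
      exact ⟨c, acks₀, h₁, by omega, h⟩
    · rw [h'] at hc
      rcases hcl : (R.state n).client i with out | ⟨op, a⟩ | ⟨t, ws, a⟩ | ⟨t, a⟩ | ⟨t, a⟩ | ⟨t, a⟩ <;>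
        rw [hcl] at hc <;> cases hc
      obtain ⟨c, acks₀, h₁, h₂, h⟩ := ih (by omega) (by omega) hcl
      exact ⟨c, acks₀, h₁, by omega, h⟩
    · rw [h'] at hc
      rcases hcl : (R.state n).client i with out | ⟨_ | v, a⟩ | ⟨t, ws, a⟩ | ⟨t, a⟩ | ⟨t, a⟩ |
        ⟨t, a⟩ <;> rw [hcl] at hc hQ <;> cases hc
      exact ⟨n, a, by omega, by omega, hcl, hQ⟩
    · rw [h'] at hc
      cases hc

/-- After a complete write with the tag `t`, a quorum of servers has records in which `t` is finalized. -/
theorem exists_quorum_finalized (hR : (R.state 0).Fresh) {i : Fin N} {v : Fin k → A} {a b : ℕ}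
    (h : R.CompleteOp i (.write v) a b) {t : Tag N} {acks : Acks N A}
    (hc : (R.state b).client i = .finalizeAgainW t acks) :
    ∃ Q, IsQuorum k e Q ∧
      ∀ j ∈ Q, ∃ r ∈ ((R.state b).server j).store, r.tag = t ∧ r.phase ∈ finPhases := by
  obtain ⟨c, acks₀, hac, hcb, hc, hQ⟩ := h.write_phases h.1 le_rfl hc
  refine ⟨_, hQ, fun j hj => ?_⟩
  obtain ⟨r, hr⟩ := mem_ackSet.1 hj
  obtain ⟨p, q, -, hp, hq, -, hs⟩ := exists_handled (r := r) hR hac.le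
    (calls_ne_of_invoke h.2.1 hac) (Or.inl (by rw [hc]; exact hr))
  rw [hc] at hq
  cases hq
  obtain ⟨x, hx, hxt, hxp⟩ := exists_mem_updatePhase_fin ((R.state p).server j).store t none
  have hs' : x ∈ ((R.state (p + 1)).server j).store := by
    rw [hs]
    exact hx
  obtain ⟨x', hx', hxt', -, hxp'⟩ := R.persists (show p + 1 ≤ b by omega) j x hs'
  exact ⟨x', hx', hxt'.trans hxt, hxp' hxp⟩

/-- A reader that starts its query when a quorum has finalized `t` obtains a tag that is not smaller. -/
theorem le_maxTag_of_quorum_finalized (hk : 1 ≤ k) (hR : (R.state 0).Fresh) {i : Fin N} {m n : ℕ}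
    (hmn : m ≤ n) (hcalls : (R.state m).calls i ≠ (R.state n).calls i) {t : Tag N}
    {Q : Finset (Fin N)} (hQ : IsQuorum k e Q)
    (hQt : ∀ j ∈ Q, ∃ r ∈ ((R.state m).server j).store, r.tag = t ∧ r.phase ∈ finPhases)
    {acks : Acks N A} (hc : (R.state n).client i = .query .read acks)
    (hacks : IsQuorum k e (ackSet acks)) : t ≤ maxTag acks := by
  obtain ⟨j, hj, hj'⟩ := hQ.exists_common hk hacks
  obtain ⟨r, hr⟩ := mem_ackSet.1 hj'
  obtain ⟨p, q, hp, -, hq, hr', -⟩ := exists_handled (r := r) hR hmn hcalls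
    (Or.inl (by rw [hc]; exact hr))
  rw [hc] at hq
  cases hq
  obtain ⟨x, hx, hxt, hxp⟩ := hQt j hj
  obtain ⟨x', hx', hxt', -, hxp'⟩ := R.persists hp.le j x hx
  have h₁ := le_maxPhase hx' (hxp' hxp)
  rw [hxt', hxt] at h₁
  have h₂ := le_maxTag hr
  rw [hr'.1] at h₂
  exact h₁.trans h₂

/-- The tag with which a reader finalizes belongs to a version `v` of which a quorum of servers has
coded elements, and no other coded elements are stored for that tag. -/
theorem exists_stored_version {f : ℕ} (hk : 1 ≤ k) (hkN : k + 2 * (f + e) ≤ N)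
    (hR : (R.state 0).Fresh) {t : Tag₀ N} {i : Fin N} {n : ℕ} {acks : Acks N A}
    (hc : (R.state n).client i = .finalizeR t acks)
    (ht : ∀ τ : Tag N, t = τ → ∃ m ≤ n, ¬ (R.state m).HasTag τ) :
    ∃ v, R.IsVersion n t v ∧
      (∃ Q, IsQuorum k e Q ∧ ∀ j ∈ Q, ∀ p, n ≤ p →
        storedWord ((R.state p).server j).store (P.code P.v₀ j) t ≠ none) ∧
      ∀ j p, n ≤ p → storedWord ((R.state p).server j).store (P.code P.v₀ j) t = none ∨
        storedWord ((R.state p).server j).store (P.code P.v₀ j) t = some (P.code v j) := by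
  cases t using WithBot.recBotCoe with
  | bot =>
    -- For t₀ every server always has the coded element of the default value, so the set of all
    -- servers is a suitable quorum.
    refine ⟨P.v₀, Or.inl ⟨rfl, rfl⟩, ⟨Finset.univ, ?_, fun j _ p _ h => ?_⟩, fun j p _ => Or.inr rfl⟩
    · simp only [IsQuorum, Finset.card_univ, Fintype.card_fin]
      omega
    · cases h
  | coe τ =>
    obtain ⟨m, hm, hτ⟩ := ht τ rfl
    -- The reader's own finalize request shows that `τ` has left its pre-write phase.
    have hu : ¬ (R.state n).Unfinalized τ := fun hu =>
      hu.client i i (.finalize .reader τ) (by rw [hc]; rfl) rfl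
    obtain ⟨v, hver, hv, hw⟩ := exists_version hk hR hτ hm hu
    refine ⟨v, hver, ?_, fun j p hp => ((hw.carries hk hR hp hv).store j).storedWord _⟩
    obtain ⟨p₀, hp₀, Q, hQ, hQw, -⟩ := hw
    refine ⟨Q, hQ, fun j hj p hp => ?_⟩
    obtain ⟨x, hx, hxt, hxw⟩ := hQw j hj
    obtain ⟨x', hx', hxt', hxw', -⟩ := R.persists (hp₀.trans hp) j x hx
    exact storedWord_ne_none hx' (hxt'.trans hxt) (hxw' hxw) _

/-- `hold` is where legality enters: it keeps out tags left over from the arbitrary starting state,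
for which no pre-write by a writer can be guaranteed. For other tags, the finalize quorum meets the
quorum that stores coded elements. -/
theorem CompleteOp.read_returns {f : ℕ} (hcode : IsMDS P.code) (hmal : P.malicious.card ≤ e)
    (hk : 1 ≤ k) (hkN : k + 2 * (f + e) ≤ N) (hR : (R.state 0).Fresh) {i : Fin N} {a b : ℕ}
    (h : R.CompleteOp i .read a b)
    (hold : ∀ c (acks : Acks N A), a < c → c < b → (R.state c).client i = .query .read acks →
      IsQuorum k e (ackSet acks) → ∀ τ : Tag N, maxTag acks = τ →
        ∃ m ≤ a, ¬ (R.state m).HasTag τ) :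
    ∃ (t : Tag₀ N) (acks : Acks N A) (v : Fin k → A),
      (R.state b).client i = .finalizeR t acks ∧
      R.IsVersion b t v ∧
      k ≤ (matching P.code (ackWord t acks) v).card ∧
      k + 2 * e ≤ (received (ackWord t acks)).card ∧
      (received (ackWord t acks)).card ≤ (matching P.code (ackWord t acks) v).card + e ∧
      (R.state (b + 1)).client i = .idle (some v) := by
  obtain ⟨hQb, hb⟩ := (R.step b).of_return (h.2.2.1 b h.1 le_rfl) h.2.2.2
  rcases h.read_phases h.1 le_rfl with ⟨acks, hc⟩ | ⟨c, acks₀, acks, hac, hcb, hc, hQc, hc', hcl⟩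
  · have hidle := h.2.2.2
    rw [hb, hc] at hidle
    exact hidle.elim
  rw [hcl] at hQb hb
  replace hQb : IsQuorum k e (ackSet acks) := hQb
  set t := maxTag acks₀ with ht
  obtain ⟨v, hver, ⟨Q, hQ, hQw⟩, hv⟩ := exists_stored_version hk hkN hR hc' fun τ hτ => by
    obtain ⟨m, hm, hm'⟩ := hold c acks₀ hac hcb hc hQc τ hτ
    exact ⟨m, by omega, hm'⟩
  -- The query and finalize phases send different requests, hence are different calls; all
  -- acknowledgments of the finalize phase were therefore produced after state `c`.
  have hcalls : (R.state c).calls i ≠ (R.state b).calls i := by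
    intro h
    have := request_eq_of_calls_eq hcb.le h i
    rw [hcl, hc] at this
    cases this
  have hreply : ∀ j r, acks j = some r → r.tag = t ∧
      (j ∉ P.malicious → r.word = none ∨ r.word = some (P.code v j)) ∧
      (j ∈ Q → r.word ≠ none) := by
    intro j r hr
    obtain ⟨p, q, hcp, -, hq, ⟨htag, hgood, hword⟩, hs⟩ := exists_handled (r := r) hR hcb.le hcalls
      (Or.inl (by rw [hcl]; exact hr))
    rw [hcl] at hq
    cases hq
    change ((R.state (p + 1)).server j).store =
      updatePhase ((R.state p).server j).store t none .fin at hs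
    change _ → r.word =
      storedWord (updatePhase ((R.state p).server j).store t none .fin) (P.code P.v₀ j) t at hgood
    change storedWord (updatePhase ((R.state p).server j).store t none .fin) (P.code P.v₀ j) t
      ≠ none → _ at hword
    -- The reply reads the storage after its own update, which is that of state `p + 1`; this state
    -- is late enough for `hQw` and `hv`.
    rw [← hs] at hgood hword
    refine ⟨htag, fun hj => ?_, fun hj => hword (hQw j hj _ (by omega))⟩
    rw [hgood hj]
    exact hv j _ (by omega)
  have hrec : k + 2 * e ≤ (received (ackWord t acks)).card := by
    refine (hQb.card_inter hQ).trans (Finset.card_le_card fun j hj => ?_)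
    obtain ⟨hj, hjQ⟩ := Finset.mem_inter.1 hj
    obtain ⟨r, hr⟩ := mem_ackSet.1 hj
    obtain ⟨htag, -, hw⟩ := hreply j r hr
    simp only [received, Finset.mem_filter, Finset.mem_univ, true_and]
    rw [ackWord_of_tag_eq hr htag]
    exact Option.isSome_iff_ne_none.2 (hw hjQ)
  have hmatch : (received (ackWord t acks)).card ≤
      (matching P.code (ackWord t acks) v).card + e := by
    refine card_received_le hmal fun j hj => ?_
    rcases hr : acks j with _ | r
    · exact Or.inl (by simp [ackWord, hr])
    · obtain ⟨htag, hw, -⟩ := hreply j r hr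
      rw [ackWord_of_tag_eq hr htag]
      exact hw hj
  refine ⟨t, acks, v, hcl, hver.mono (by omega), by omega, hrec, hmatch, ?_⟩
  rw [hb]
  exact congrArg Client.idle (decode_eq_some hcode hrec hmatch)

theorem LegalFrom.fresh {n₀ : ℕ} (h : R.LegalFrom n₀) : (R.state 0).Fresh := by
  rcases h with ⟨-, h⟩ | ⟨h, -⟩
  · exact h.1.fresh
  · exact h.fresh

/-- In a legal execution, every tag that a reader obtains has been absent from an earlier state. -/
theorem LegalFrom.exists_not_hasTag (hk : 1 ≤ k) {n₀ : ℕ} (hlegal : R.LegalFrom n₀) {i : Fin N}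
    {a c : ℕ} (hna : n₀ ≤ a) (ha : R.label a = .invoke i .read) (hac : a < c) {acks : Acks N A}
    (hc : (R.state c).client i = .query .read acks) (hQ : IsQuorum k e (ackSet acks)) {τ : Tag N}
    (hτ : maxTag acks = τ) : ∃ m ≤ a, ¬ (R.state m).HasTag τ := by
  have hR := hlegal.fresh
  rcases hlegal with ⟨-, hs⟩ | ⟨-, i', a', b', t, ⟨⟨v, hop⟩, ⟨acks', hb'⟩, m, hm, hmax⟩, rfl⟩
  · exact ⟨0, Nat.zero_le _, hs.not_hasTag τ⟩
  · obtain ⟨Q, hQ', hQt⟩ := exists_quorum_finalized hR hop hb'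
    have hQt' : ∀ j ∈ Q, ∃ r ∈ ((R.state a).server j).store, r.tag = t ∧ r.phase ∈ finPhases := by
      intro j hj
      obtain ⟨x, hx, hxt, hxp⟩ := hQt j hj
      obtain ⟨x', hx', hxt', -, hxp'⟩ := R.persists (show b' ≤ a by omega) j x hx
      exact ⟨x', hx', hxt'.trans hxt, hxp' hxp⟩
    have hle := le_maxTag_of_quorum_finalized hk hR hac.le (calls_ne_of_invoke ha hac) hQ' hQt' hc hQ
    rw [hτ] at hle
    have hle := WithBot.coe_le_coe.1 hle
    have hop' := hop.1
    -- If `τ` occurred in both states of the validity condition, it would be smaller than `t`,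
    -- against `hle`.
    by_contra! hall
    exact absurd (hmax τ (hall 0 (Nat.zero_le _)) (hall m (by omega))) (not_lt_of_ge hle)

end Execution

/-! ### Circulation of the tokens and progress of a call -/

section Token

variable {N k e : ℕ} {A : Type} {P : Params N k e A} {s s' : State N k A} {l : Label N k A}

/-- The step by which the token between client `i` and server `j` leaves its position. -/
def exitLabel (k : ℕ) (i j : Fin N) : Wire N A → Label N k A
  | .atClient => .pingDepart i j
  | .toServer _ => .pingArrive i j
  | .atServer => .pongDepart i j
  | .toClient _ => .pongArrive i j

theorem exitLabel_isAlgorithmStep (i j : Fin N) (w : Wire N A) :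
    (exitLabel k i j w).IsAlgorithmStep := by
  cases w <;> trivial

/-- Every token position has an applicable exit step, whatever the token carries; the honest reply
is always permitted, also to a malicious server. -/
theorem State.exists_step_exitLabel (P : Params N k e A) (s : State N k A) {i j : Fin N}
    (hi : i ∉ s.deadClients) (hj : j ∉ s.deadServers) :
    ∃ s', Step P s (exitLabel k i j (s.wire i j)) s' := by
  rcases hw : s.wire i j with _ | (_ | ⟨n, q⟩) | _ | m
  · exact ⟨_, .pingDepart s i j hi hw⟩
  · exact ⟨_, .pingArriveEmpty s i j hj hw⟩
  · exact ⟨_, .pingArrive s i j n q _ hj hw ⟨rfl, fun _ => rfl, id⟩⟩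
  · exact ⟨_, .pongDepart s i j hj hw⟩
  · by_cases hm : ∃ r, m = some (s.calls i, r)
    · obtain ⟨r, rfl⟩ := hm
      exact ⟨_, .pongArrive s i j r hi hw⟩
    · exact ⟨_, .pongArriveOther s i j m hi hw (not_exists.1 hm)⟩

theorem State.setPong_pongTx (s : State N k A) (j i j' i' : Fin N) (m : Option (ℕ × Reply N A)) :
    ((s.setPong j i m).server j').pongTx i' =
      if j' = j ∧ i' = i then m else (s.server j').pongTx i' := by
  by_cases hj : j' = j
  · subst hj
    by_cases hi : i' = i <;> simp [State.setPong, State.setServer, hi]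
  · simp [State.setPong, State.setServer, hj]

theorem State.setStore_pongTx (s : State N k A) (j j' : Fin N) (S : Finset (Record N A)) :
    ((s.setStore j S).server j').pongTx = (s.server j').pongTx := by
  by_cases hj : j' = j
  · subst hj
    simp [State.setStore, State.setServer]
  · simp [State.setStore, State.setServer, hj]

/-- The reply buffer for client `i` is written only when the token of this pair arrives at the
server, and that arrival is itself an exit step. The buffer can thus be tracked together with the
token. -/
theorem Step.token_stays (h : Step P s l s') {i j : Fin N} (hl : l ≠ exitLabel k i j (s.wire i j)) :
    s'.wire i j = s.wire i j ∧ (s'.server j).pongTx i = (s.server j).pongTx i := by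
  cases h with
  | pingDepart i' j' alive h =>
    rw [State.setWire_wire]
    split_ifs with hij
    · obtain ⟨rfl, rfl⟩ := hij
      rw [h] at hl
      exact absurd rfl hl
    · exact ⟨rfl, rfl⟩
  | pingArriveEmpty i' j' alive h =>
    rw [State.setWire_wire]
    change _ ∧ ((s.setPong j' i' none).server j).pongTx i = _
    rw [State.setPong_pongTx]
    split_ifs with hij hji hji
    · obtain ⟨rfl, rfl⟩ := hij
      rw [h] at hl
      exact absurd rfl hl
    · exact absurd hij.symm hji
    · exact absurd hji.symm hij
    · exact ⟨rfl, rfl⟩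
  | pingArrive i' j' n q r alive h hr =>
    rw [State.setWire_wire]
    change _ ∧ (((s.setStore j' _).setPong j' i' _).server j).pongTx i = _
    rw [State.setPong_pongTx, State.setStore_pongTx]
    split_ifs with hij hji hji
    · obtain ⟨rfl, rfl⟩ := hij
      rw [h] at hl
      exact absurd rfl hl
    · exact absurd hij.symm hji
    · exact absurd hji.symm hij
    · exact ⟨rfl, rfl⟩
  | pongDepart i' j' alive h =>
    rw [State.setWire_wire]
    split_ifs with hij
    · obtain ⟨rfl, rfl⟩ := hij
      rw [h] at hl
      exact absurd rfl hl
    · exact ⟨rfl, rfl⟩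
  | pongArrive i' j' r alive h =>
    rw [State.setWire_wire]
    split_ifs with hij
    · obtain ⟨rfl, rfl⟩ := hij
      rw [h] at hl
      exact absurd rfl hl
    · exact ⟨rfl, rfl⟩
  | pongArriveOther i' j' m alive h hm =>
    rw [State.setWire_wire]
    split_ifs with hij
    · obtain ⟨rfl, rfl⟩ := hij
      rw [h] at hl
      exact absurd rfl hl
    · exact ⟨rfl, rfl⟩
  | gossipArrive i' j' m ne alive h =>
    refine ⟨rfl, ?_⟩
    by_cases hj : j = j'
    · subst hj
      simp [State.setGossipWire, State.setServer, onGossip]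
    · simp [State.setGossipWire, State.setServer, hj]
  | _ => exact ⟨rfl, rfl⟩

theorem Step.of_pingDepart {i j : Fin N} (h : Step P s (.pingDepart i j) s') :
    s'.wire i j = .toServer (((s.client i).request j).map fun q => (s.calls i, q)) := by
  cases h with
  | pingDepart _ _ alive h => simp [State.setWire_wire]

theorem Step.of_pingArrive {i j : Fin N} (h : Step P s (.pingArrive i j) s') :
    s'.wire i j = .atServer ∧ ∀ n q, s.wire i j = .toServer (some (n, q)) →
      ∃ r, (s'.server j).pongTx i = some (n, r) := by
  cases h with
  | pingArriveEmpty _ _ alive h =>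
    refine ⟨by simp [State.setWire_wire], fun n q h' => ?_⟩
    rw [h] at h'
    cases h'
  | pingArrive _ _ n q r alive h hr =>
    refine ⟨by simp [State.setWire_wire], fun n' q' h' => ⟨r, ?_⟩⟩
    rw [h] at h'
    cases h'
    simp [State.setWire, State.setPong, State.setServer]

theorem Step.of_pongDepart {i j : Fin N} (h : Step P s (.pongDepart i j) s') :
    s'.wire i j = .toClient ((s.server j).pongTx i) := by
  cases h with
  | pongDepart _ _ alive h => simp [State.setWire_wire]

theorem Step.of_pongArrive {i j : Fin N} (h : Step P s (.pongArrive i j) s') :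
    s'.wire i j = .atClient ∧ ∀ r, s.wire i j = .toClient (some (s.calls i, r)) →
      s'.client i = (s.client i).addAck j r := by
  cases h with
  | pongArrive _ _ r alive h =>
    refine ⟨by simp [State.setWire_wire], fun r' h' => ?_⟩
    rw [h] at h'
    cases h'
    simp [State.setWire, State.setClient]
  | pongArriveOther _ _ m alive h hm =>
    refine ⟨by simp [State.setWire_wire], fun r h' => ?_⟩
    rw [h] at h'
    exact absurd (Wire.toClient.inj h') (hm r)

theorem Client.acks_addAck_self {c : Client N k A} (hc : ¬ c.Idle) (j : Fin N) (r : Reply N A) :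
    (c.addAck j r).acks j = some r := by
  cases c <;> first | exact absurd trivial hc | simp [Client.addAck, Client.acks]

theorem Client.mem_ackSet_addAck {c : Client N k A} {j j' : Fin N} {r : Reply N A}
    (h : j' ∈ ackSet c.acks) : j' ∈ ackSet (c.addAck j r).acks := by
  obtain ⟨r', hr'⟩ := mem_ackSet.1 h
  rw [mem_ackSet]
  by_cases hj : j' = j
  · subst hj
    refine ⟨r, c.acks_addAck_self (fun hi => ?_) j' r⟩
    cases c <;> first | exact hi | cases hr'
  · refine ⟨r', ?_⟩
    cases c <;> simp_all [Client.addAck, Client.acks]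

theorem Client.exists_request {c : Client N k A} (hc : ¬ c.Idle) (j : Fin N) :
    ∃ q, c.request j = some q := by
  cases c <;> first | exact absurd trivial hc | exact ⟨_, rfl⟩

/-- The number of calls of `qrmAccess` that the current procedure still has to complete. -/
def Client.remaining : Client N k A → ℕ
  | .idle _ => 0
  | .query _ _ => 4
  | .prewrite _ _ _ => 3
  | .finalizeW _ _ => 2
  | .finalizeAgainW _ _ => 1
  | .finalizeR _ _ => 1

theorem Client.remaining_advance {c : Client N k A} (hc : ¬ c.Idle) (i : Fin N) :
    (c.advance P i).remaining < c.remaining := by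
  rcases c with out | ⟨_ | v, a⟩ | ⟨t, ws, a⟩ | ⟨t, a⟩ | ⟨t, a⟩ | ⟨t, a⟩ <;>
    first | exact absurd trivial hc | simp [Client.advance, Client.remaining]

theorem Client.remaining_addAck (c : Client N k A) (j : Fin N) (r : Reply N A) :
    (c.addAck j r).remaining = c.remaining := by
  cases c <;> rfl

/-- Unless its call returns, a busy client can only collect acknowledgments; it cannot be invoked
again. -/
theorem Step.of_not_advance (h : Step P s l s') {i : Fin N} (hl : l ≠ .advance i)
    (hb : ¬ (s.client i).Idle) :
    ¬ (s'.client i).Idle ∧ s'.calls i = s.calls i ∧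
      (s'.client i).remaining = (s.client i).remaining ∧
      ackSet (s.client i).acks ⊆ ackSet (s'.client i).acks := by
  rcases h.client i with ⟨h', hn⟩ | ⟨j, r, h', hn, -⟩ | ⟨h', -⟩ | ⟨op, -, h', -⟩
  · rw [h']
    exact ⟨hb, hn, rfl, subset_rfl⟩
  · rw [h', Client.idle_addAck, Client.remaining_addAck]
    exact ⟨hb, hn, rfl, fun _ => Client.mem_ackSet_addAck⟩
  · exact absurd h' hl
  · exact absurd h' hb

end Token

/-! ### Termination under fairness -/

namespace Execution

variable {N k e : ℕ} {A : Type} {P : Params N k e A} {R : Execution P}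

/-- The token between a client and a server that never fail leaves its position. -/
theorem exists_exit (hfair : R.Fair) {i j : Fin N} (hi : ∀ n, i ∉ (R.state n).deadClients)
    (hj : ∀ n, j ∉ (R.state n).deadServers) (n : ℕ) :
    ∃ m, n ≤ m ∧ (R.state m).wire i j = (R.state n).wire i j ∧
      ((R.state m).server j).pongTx i = ((R.state n).server j).pongTx i ∧
      R.label m = exitLabel k i j ((R.state n).wire i j) := by
  classical
  set l := exitLabel k i j ((R.state n).wire i j) with hl
  have hstay : ∀ m, n ≤ m → (∀ p, n ≤ p → p < m → R.label p ≠ l) →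
      (R.state m).wire i j = (R.state n).wire i j ∧
        ((R.state m).server j).pongTx i = ((R.state n).server j).pongTx i := by
    intro m hm
    induction m, hm using Nat.le_induction with
    | base => exact fun _ => ⟨rfl, rfl⟩
    | succ m hm ih =>
      intro hp
      obtain ⟨h₁, h₂⟩ := ih fun p hp₁ hp₂ => hp p hp₁ (by omega)
      have hne : R.label m ≠ exitLabel k i j ((R.state m).wire i j) := by
        rw [h₁]
        exact hp m hm (by omega)
      obtain ⟨h₃, h₄⟩ := (R.step m).token_stays hne
      exact ⟨h₃.trans h₁, h₄.trans h₂⟩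
  have hex : ∃ m, n ≤ m ∧ R.label m = l := by
    by_contra! hne
    -- A token that never left would keep the same exit step applicable forever, and fairness would
    -- force that step to be taken.
    have hfreq : ∃ᶠ m in Filter.atTop, ∃ s' : State N k A, Step P (R.state m) l s' := by
      refine (Filter.eventually_atTop.2 ⟨n, fun m hm => ?_⟩).frequently
      rw [hl, ← (hstay m hm fun p hp _ => hne p hp).1]
      exact (R.state m).exists_step_exitLabel P (hi m) (hj m)
    obtain ⟨m, hm, h⟩ := Filter.frequently_atTop.1
      (hfair l (exitLabel_isAlgorithmStep i j _) hfreq) n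
    exact hne m hm h
  obtain ⟨hm, hlm⟩ := Nat.find_spec hex
  obtain ⟨h₁, h₂⟩ := hstay _ hm fun p hp hpm h => Nat.find_min hex hpm ⟨hp, h⟩
  exact ⟨_, hm, h₁, h₂, hlm⟩

/-- The token returns to the client. -/
theorem exists_atClient (hfair : R.Fair) {i j : Fin N} (hi : ∀ n, i ∉ (R.state n).deadClients)
    (hj : ∀ n, j ∉ (R.state n).deadServers) (n : ℕ) :
    ∃ m, n ≤ m ∧ (R.state m).wire i j = .atClient := by
  have hto : ∀ n x, (R.state n).wire i j = .toClient x →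
      ∃ m, n ≤ m ∧ (R.state m).wire i j = .atClient := by
    intro n x hw
    obtain ⟨m, hm, -, -, hl⟩ := exists_exit hfair hi hj n
    rw [hw] at hl
    exact ⟨m + 1, by omega, (hl ▸ R.step m : Step P _ (.pongArrive i j) _).of_pongArrive.1⟩
  have hat : ∀ n, (R.state n).wire i j = .atServer →
      ∃ m, n ≤ m ∧ (R.state m).wire i j = .atClient := by
    intro n hw
    obtain ⟨m, hm, -, -, hl⟩ := exists_exit hfair hi hj n
    rw [hw] at hl
    obtain ⟨m', hm', h⟩ := hto (m + 1) _
      (hl ▸ R.step m : Step P _ (.pongDepart i j) _).of_pongDepart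
    exact ⟨m', by omega, h⟩
  rcases hw : (R.state n).wire i j with _ | x | _ | x
  · exact ⟨n, le_rfl, hw⟩
  · obtain ⟨m, hm, -, -, hl⟩ := exists_exit hfair hi hj n
    rw [hw] at hl
    obtain ⟨m', hm', h⟩ := hat (m + 1)
      (hl ▸ R.step m : Step P _ (.pingArrive i j) _).of_pingArrive.1
    exact ⟨m', by omega, h⟩
  · exact hat n hw
  · exact hto n x hw

/-- A server that does not fail acknowledges a call that does not return. -/
theorem exists_ack (hfair : R.Fair) {i j : Fin N} (hi : ∀ n, i ∉ (R.state n).deadClients)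
    (hj : ∀ n, j ∉ (R.state n).deadServers) {n : ℕ}
    (hbusy : ∀ m, n ≤ m → ¬ ((R.state m).client i).Idle)
    (hcalls : ∀ m, n ≤ m → (R.state m).calls i = (R.state n).calls i) :
    ∃ m, n ≤ m ∧ j ∈ ackSet ((R.state m).client i).acks := by
  -- The token may be carrying something older, so one first waits until it is back at the client;
  -- the next full round then carries the current request and its reply.
  obtain ⟨m₀, hm₀, hw₀⟩ := exists_atClient hfair hi hj n
  obtain ⟨m₁, hm₁, -, -, hl₁⟩ := exists_exit hfair hi hj m₀
  rw [hw₀] at hl₁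
  have hw₁ := (hl₁ ▸ R.step m₁ : Step P _ (.pingDepart i j) _).of_pingDepart
  obtain ⟨q, hq⟩ := Client.exists_request (hbusy m₁ (by omega)) j
  rw [hq, Option.map_some, hcalls m₁ (by omega)] at hw₁
  obtain ⟨m₂, hm₂, hw₂, -, hl₂⟩ := exists_exit hfair hi hj (m₁ + 1)
  rw [hw₁] at hl₂ hw₂
  obtain ⟨hw₂', hp₂⟩ := (hl₂ ▸ R.step m₂ : Step P _ (.pingArrive i j) _).of_pingArrive
  obtain ⟨r, hr⟩ := hp₂ _ _ hw₂
  -- `hp₃` ensures that the reply is still in the buffer when the token departs.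
  obtain ⟨m₃, hm₃, -, hp₃, hl₃⟩ := exists_exit hfair hi hj (m₂ + 1)
  rw [hw₂'] at hl₃
  have hw₃ := (hl₃ ▸ R.step m₃ : Step P _ (.pongDepart i j) _).of_pongDepart
  rw [hp₃, hr] at hw₃
  obtain ⟨m₄, hm₄, hw₄, -, hl₄⟩ := exists_exit hfair hi hj (m₃ + 1)
  rw [hw₃] at hl₄ hw₄
  have hc := (hl₄ ▸ R.step m₄ : Step P _ (.pongArrive i j) _).of_pongArrive.2 r
    (by rw [hw₄, hcalls m₄ (by omega)])
  refine ⟨m₄ + 1, by omega, mem_ackSet.2 ⟨r, ?_⟩⟩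
  rw [hc]
  exact Client.acks_addAck_self (hbusy m₄ (by omega)) j r

theorem deadServers_mono : Monotone fun n => (R.state n).deadServers := by
  refine monotone_nat_of_le_succ fun n => ?_
  have h := R.step n
  generalize R.state n = s, R.state (n + 1) = s', R.label n = l at h
  cases h with
  | crashServer j => exact Finset.subset_insert _ _
  | _ => exact subset_rfl

open Classical in
/-- The servers that never fail. -/
noncomputable def correctServers (R : Execution P) : Finset (Fin N) :=
  Finset.univ.filter fun j => ∀ n, j ∉ (R.state n).deadServers

/-- At least N - f servers never fail, and 2(N - f) ≥ N + k + 2e is exactly `hkN`. -/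
theorem isQuorum_correctServers {f : ℕ} (hkN : k + 2 * (f + e) ≤ N)
    (hf : ∀ n, (R.state n).deadServers.card ≤ f) : IsQuorum k e R.correctServers := by
  classical
  have hex : ∀ j : Fin N, ∃ n, j ∉ R.correctServers → j ∈ (R.state n).deadServers := by
    intro j
    by_cases hj : j ∈ R.correctServers
    · exact ⟨0, fun h => absurd hj h⟩
    · have hj' := hj
      simp only [correctServers, Finset.mem_filter, Finset.mem_univ, true_and, not_forall,
        not_not] at hj'
      obtain ⟨n, hn⟩ := hj'
      exact ⟨n, fun _ => hn⟩
  choose g hg using hex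
  -- Failures are permanent and there are finitely many servers, so at one common time all servers
  -- that ever fail have failed.
  have hsub : R.correctServersᶜ ⊆ (R.state (Finset.univ.sup g)).deadServers := fun j hj =>
    deadServers_mono (Finset.le_sup (f := g) (Finset.mem_univ j)) (hg j (Finset.mem_compl.1 hj))
  have h₁ := (Finset.card_le_card hsub).trans (hf _)
  have h₂ := Finset.card_add_card_compl R.correctServers
  rw [Fintype.card_fin] at h₂
  unfold IsQuorum
  omega

/-- Every call of `qrmAccess` of a client that does not fail returns. -/
theorem exists_advance {f : ℕ} (hkN : k + 2 * (f + e) ≤ N) (hfair : R.Fair)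
    (hf : ∀ n, (R.state n).deadServers.card ≤ f) {i : Fin N}
    (hi : ∀ n, i ∉ (R.state n).deadClients) {n : ℕ} (hn : ¬ ((R.state n).client i).Idle) :
    ∃ m, n ≤ m ∧ R.label m = .advance i ∧ ¬ ((R.state m).client i).Idle ∧
      ((R.state m).client i).remaining = ((R.state n).client i).remaining := by
  classical
  have hstay : ∀ m, n ≤ m → (∀ p, n ≤ p → p < m → R.label p ≠ .advance i) →
      ¬ ((R.state m).client i).Idle ∧ (R.state m).calls i = (R.state n).calls i ∧
        ((R.state m).client i).remaining = ((R.state n).client i).remaining := by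
    intro m hm
    induction m, hm using Nat.le_induction with
    | base => exact fun _ => ⟨hn, rfl, rfl⟩
    | succ m hm ih =>
      intro hp
      obtain ⟨h₁, h₂, h₃⟩ := ih fun p hp₁ hp₂ => hp p hp₁ (by omega)
      obtain ⟨h₄, h₅, h₆, -⟩ := (R.step m).of_not_advance (hp m hm (by omega)) h₁
      exact ⟨h₄, h₅.trans h₂, h₆.trans h₃⟩
  have hex : ∃ m, n ≤ m ∧ R.label m = .advance i := by
    by_contra! hne
    have hbusy : ∀ m, n ≤ m → ¬ ((R.state m).client i).Idle :=
      fun m hm => (hstay m hm fun p hp _ => hne p hp).1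
    have hacks : ∀ j, ∃ m, n ≤ m ∧
        (j ∈ R.correctServers → j ∈ ackSet ((R.state m).client i).acks) := by
      intro j
      by_cases hj : j ∈ R.correctServers
      · obtain ⟨m, hm, h⟩ := exists_ack hfair hi (Finset.mem_filter.1 hj).2 hbusy
          fun m hm => (hstay m hm fun p hp _ => hne p hp).2.1
        exact ⟨m, hm, fun _ => h⟩
      · exact ⟨n, le_rfl, fun h => absurd h hj⟩
    choose g hg hgj using hacks
    have hmono : ∀ m m', n ≤ m → m ≤ m' →
        ackSet ((R.state m).client i).acks ⊆ ackSet ((R.state m').client i).acks := by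
      intro m m' hm hmm
      induction m', hmm using Nat.le_induction with
      | base => exact subset_rfl
      | succ m' hmm ih =>
        exact ih.trans ((R.step m').of_not_advance (hne m' (by omega)) (hbusy m' (by omega))).2.2.2
    have hfreq : ∃ᶠ m in Filter.atTop, ∃ s' : State N k A, Step P (R.state m) (.advance i) s' := by
      -- Past the latest acknowledgment time of a correct server, the acknowledgments contain a
      -- quorum forever, so the return of the call stays applicable.
      refine (Filter.eventually_atTop.2 ⟨n ⊔ Finset.univ.sup g, fun m hm => ?_⟩).frequently
      obtain ⟨hnm, hm⟩ := sup_le_iff.1 hm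
      refine ⟨_, .advance _ i (hi m) (hbusy m hnm)
        ((isQuorum_correctServers hkN hf).mono fun j hj => ?_)⟩
      exact hmono (g j) m (hg j) ((Finset.le_sup (Finset.mem_univ j)).trans hm) (hgj j hj)
    obtain ⟨m, hm, h⟩ := Filter.frequently_atTop.1 (hfair (.advance i) trivial hfreq) n
    exact hne m hm h
  obtain ⟨hm, hlm⟩ := Nat.find_spec hex
  obtain ⟨h₁, -, h₃⟩ := hstay _ hm fun p hp hpm h => Nat.find_min hex hpm ⟨hp, h⟩
  exact ⟨_, hm, hlm, h₁, h₃⟩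

/-- Every operation of a client that does not fail terminates. -/
theorem exists_idle {f : ℕ} (hkN : k + 2 * (f + e) ≤ N) (hfair : R.Fair)
    (hf : ∀ n, (R.state n).deadServers.card ≤ f) {i : Fin N}
    (hi : ∀ n, i ∉ (R.state n).deadClients) {n : ℕ} (hn : ¬ ((R.state n).client i).Idle) :
    ∃ b, n ≤ b ∧ ((R.state (b + 1)).client i).Idle := by
  induction hr : ((R.state n).client i).remaining using Nat.strong_induction_on generalizing n with
  | _ x ih =>
    obtain ⟨m, hm, hl, hb, hrem⟩ := exists_advance hkN hfair hf hi hn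
    by_cases hidle : ((R.state (m + 1)).client i).Idle
    · exact ⟨m, hm, hidle⟩
    · obtain ⟨-, -, hc, -⟩ := (hl ▸ R.step m).of_advance
      have hlt := Client.remaining_advance (P := P) hb i
      rw [← hc, hrem, hr] at hlt
      obtain ⟨b, hb', h⟩ := ih _ hlt hidle rfl
      exact ⟨b, by omega, h⟩

end Execution

end CAS

/-! ### The liveness theorem -/

theorem mainTheorem4 (N k e f : ℕ) (A : Type) (P : CAS.Params N k e A)
    (hcode : CAS.IsMDS P.code) (hmal : P.malicious.card ≤ e)
    (hk : 1 ≤ k) (hkN : k + 2 * (f + e) ≤ N)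
    (R : CAS.Execution P) (n₀ : ℕ)
    (hlegal : R.LegalFrom n₀) (hfair : R.Fair)
    (hf : ∀ n, (R.state n).deadServers.card ≤ f) :
    (∀ (i : Fin N) (n : ℕ), n₀ ≤ n → ¬ ((R.state n).client i).Idle →
      (∀ m, i ∉ (R.state m).deadClients) → ∃ b, n ≤ b ∧ ((R.state (b + 1)).client i).Idle) ∧
    (∀ (i : Fin N) (a b : ℕ), n₀ ≤ a → R.CompleteOp i .read a b →
      ∃ (t : CAS.Tag₀ N) (acks : CAS.Acks N A) (v : Fin k → A),
        (R.state b).client i = .finalizeR t acks ∧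
        R.IsVersion b t v ∧
        k ≤ (CAS.matching P.code (CAS.ackWord t acks) v).card ∧
        k + 2 * e ≤ (CAS.received (CAS.ackWord t acks)).card ∧
        (CAS.received (CAS.ackWord t acks)).card ≤
          (CAS.matching P.code (CAS.ackWord t acks) v).card + e ∧
        (R.state (b + 1)).client i = .idle (some v)) := by
  refine ⟨fun i n _ hbusy hi => CAS.Execution.exists_idle hkN hfair hf hi hbusy,
    fun i a b ha hop => ?_⟩
  exact hop.read_returns hcode hmal hk hkN hlegal.fresh fun c acks hac _ hc hQ τ hτ =>
    hlegal.exists_not_hasTag hk ha hop.2.1 hac hc hQ hτ
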